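/- Let $m\ge 2$, $\Sigma_m=\{0,\dots,m-1\}$, and let $\Sigma_m^{\mathbb N}$ (sequences $x=(x_i)_{i\ge1}$) carry the metric $d(x,y)=m^{-n}$, where $n$ is the length of the longest common prefix of $x\ne y$. Let $A=[a_{i,j}]_{i,j=0}^{m-1}$ be an irreducible $m\times m$ matrix with entries in $\{0,1\}$, with row sums $a_i=\sum_j a_{i,j}$. Let $1\le p<q$ be integers and $a,b\in\mathbb Z$, write $(p,q)$ for the greatest common divisor and $p=(p,q)p_1$, $q=(p,q)q_1$. Put $$X=X_A^{(p,q;a,b)}=\{x\in\Sigma_m^{\mathbb N}: A(x_{pk+a},x_{qk+b})=1\text{ for all }k\ge1\},$$ where the condition is imposed for those $k\ge 1$ for which both indices $pk+a$, $qk+b$ are positive. Partition $\{1,2,\dots\}$ into chains, the classes of the equivalence relation generated by $pk+a\sim qk+b$ ($k\ge1$, both positive). Let $L(i,n,j)$ be the number of chains with exactly $i$ members of which exactly $j$ lie in $\{1,\dots,n\}$, and let $P_{i,j}=\lim_{n\to\infty}L(i,n,j)/n$ for $1\le j\le i$. For $i\ge2$, $1\le k\le i-1$ and $s\in\Sigma_m$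 define recursively $$f_k(s,i)=\Big[\sum_{b_1,\dots,b_{k-1}}a_{s,b_1}a_{b_1,b_2}\cdots a_{b_{k-2},b_{k-1}}\,a_{b_{k-1}}\prod_{c=1}^{k-1}f_c(b_{k-c},i)\Big]^{-P_{i,i-k}/\sum_{l=0}^{k}P_{i,i-l}}$$ (for $k=1$ the bracket is the row sum $a_s$), and $$t_{\phi;i}=\sum_{j_1,\dots,j_i}a_{j_1,j_2}\cdots a_{j_{i-1},j_i}\prod_{k=1}^{i-1}f_k(j_{i-k},i).$$ If $P_{i,1}=\dots=P_{i,i}=0$ (for $i\ge 2$ and $(p,q)\mid(b-a)$ this happens exactly when $p\mid q$), the exponents are read as $0$, so that the $i$-th term of the series below is $0$. Then: 1. If $(p,q)\nmid(b-a)$, then $$\dim_H X\ \ge\ 1-\frac1p-\frac1q+\frac1p\log_m\sum_{i=0}^{m-1}a_i^{p/q}.$$ 2. If $(p,q)\mid(b-a)$ and $p>1$, then all the limits $P_{i,j}$ ($1\le j\le i$) exist, with $$P_{1,1}=1-\frac1p-\frac1q+\frac1{(p,q)p_1q_1},\qquad P_{i,j}=\frac{(q_1-1)(q_1-p_1)}{(p,q)q_1^{j+1}}\cdot\frac{p_1-1}{p_1^{\,i-j+1}}\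 (1\le j<i),\qquad P_{i,i}=\frac{q_1-1}{(p,q)q_1^{i}}\cdot\frac{p_1-1}{p_1}\ (i\ge2);$$ the series below converges; and if $X\neq\emptyset$, then $$\dim_H X\ \ge\ 1-\frac1p-\frac1q+\frac1{(p,q)p_1q_1}+\sum_{i=2}^\infty\Big(\sum_{j=1}^iP_{i,j}\Big)\log_m t_{\phi;i}.$$ 3. If $p=1$ and $A$ is primitive, then there is a unique positive vector $(t_i)_{i=0}^{m-1}$ with $t_i^q=\sum_{j=0}^{m-1}a_{i,j}t_j$ for all $i$, and if $X\neq\emptyset$, then $$\dim_H X\ \ge\ \frac{q-1}q\log_m\sum_{i=0}^{m-1}t_i.$$ -/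

import Mathlib

open Filter Topology

/-- The symbolic space `Σ_m^ℕ`: sequences `(x_i)_{i ≥ 1}` over the alphabet `{0, …, m-1}`. -/
def SymbolSeq (m : ℕ) : Type := ℕ+ → Fin m

namespace SymbolSeq

/-- The length of the longest common prefix of two distinct sequences: the largest `n` with
`x_1 ⋯ x_n = y_1 ⋯ y_n`. (For `x = y` the value is irrelevant.) -/
noncomputable def prefixLen {m : ℕ} (x y : SymbolSeq m) : ℕ :=
  PiNat.firstDiff (E := fun _ => Fin m) (fun n => x n.succPNat) (fun n => y n.succPNat)

theorem min_prefixLen_le {m : ℕ} (x y z : SymbolSeq m) (h : x ≠ z) :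
    min (prefixLen x y) (prefixLen y z) ≤ prefixLen x z := by
  refine PiNat.min_firstDiff_le (E := fun _ => Fin m) _ _ _ (fun H => h ?_)
  funext i
  have := congrFun H i.natPred
  simpa using this

open Classical in
/-- The standard metric `d(x, y) = m ^ (-n)`, `n` the length of the longest common prefix; the
cylinder `[x_1 ⋯ x_n]` is the closed ball of radius `m ^ (-n)` about `x`, and for `m ≥ 2` the
full space has Hausdorff dimension one. -/
noncomputable instance (m : ℕ) : MetricSpace (SymbolSeq m) where
  dist x y := if x = y then 0 else ((m : ℝ)⁻¹) ^ prefixLen x y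
  dist_self x := by simp
  dist_comm x y := by
    have h : prefixLen x y = prefixLen y x := PiNat.firstDiff_comm _ _
    simp only [h, eq_comm]
  dist_triangle x y z := by
    have nn : ∀ u v : SymbolSeq m, 0 ≤ (if u = v then 0 else ((m : ℝ)⁻¹) ^ prefixLen u v) := by
      intro u v
      split_ifs <;> positivity
    by_cases hxz : x = z
    · simpa [hxz] using add_nonneg (nn z y) (nn y z)
    by_cases hxy : x = y
    · simp [hxy]
    by_cases hyz : y = z
    · simp [hyz]
    have hm : 0 < m := Fin.pos (x 1)
    have h1 : ((m : ℝ)⁻¹) ≤ 1 := inv_le_one_of_one_le₀ (by exact_mod_cast hm)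
    have h0 : (0 : ℝ) ≤ (m : ℝ)⁻¹ := by positivity
    simp only [hxz, hxy, hyz, if_false]
    rcases min_le_iff.1 (min_prefixLen_le x y z hxz) with h | h
    · exact (pow_le_pow_of_le_one h0 h1 h).trans (le_add_of_nonneg_right (by positivity))
    · exact (pow_le_pow_of_le_one h0 h1 h).trans (le_add_of_nonneg_left (by positivity))
  eq_of_dist_eq_zero := by
    intro x y h
    by_contra hxy
    have hm : 0 < m := Fin.pos (x 1)
    simp only [hxy, if_false] at h
    have : (0 : ℝ) < ((m : ℝ)⁻¹) ^ prefixLen x y := by positivity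
    exact this.ne' h

end SymbolSeq

namespace AffineShift

/-- The positions `u` and `v` are linked by the affine constraint: `(u, v) = (pk + a, qk + b)`
for some integer `k ≥ 1`. (Positions are positive, so a `k ≥ 1` for which `pk + a` or `qk + b`
is not a position links nothing.) -/
def Linked (p q : ℕ) (a b : ℤ) (u v : ℕ+) : Prop :=
  ∃ k : ℕ, 1 ≤ k ∧ ((u : ℕ) : ℤ) = p * k + a ∧ ((v : ℕ) : ℤ) = q * k + b

/-- The affine multiplicative shift `X_A^{(p,q;a,b)}`: all sequences with
`A(x_{pk+a}, x_{qk+b}) = 1` for all `k ≥ 1`. -/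
def shift {m : ℕ} (A : Matrix (Fin m) (Fin m) ℝ) (p q : ℕ) (a b : ℤ) : Set (SymbolSeq m) :=
  {x | ∀ u v : ℕ+, Linked p q a b u v → A (x u) (x v) = 1}

/-- The chain of a position: its class under the equivalence relation generated by `Linked`. -/
def chain (p q : ℕ) (a b : ℤ) (u : ℕ+) : Set ℕ+ :=
  {v | Relation.EqvGen (Linked p q a b) u v}

/-- The family of all chains with exactly `i` members. -/
def chains (p q : ℕ) (a b : ℤ) (i : ℕ) : Set (Set ℕ+) :=
  {U | (∃ u, U = chain p q a b u) ∧ U.encard = i}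

/-- `L(i, n, j)`: the number of chains with exactly `i` members of which exactly `j` lie in
`{1, …, n}`. -/
noncomputable def chainCount (p q : ℕ) (a b : ℤ) (i n j : ℕ) : ℕ :=
  {U | U ∈ chains p q a b i ∧ (U ∩ {u : ℕ+ | (u : ℕ) ≤ n}).encard = j}.ncard

/-- `P_{i,j} = lim_n L(i, n, j) / n`. -/
noncomputable def chainDensity (p q : ℕ) (a b : ℤ) (i j : ℕ) : ℝ :=
  limUnder atTop (fun n : ℕ => (chainCount p q a b i n j : ℝ) / n)

/-- The exponent `-P_{i,i-k} / ∑_{l=0}^{k} P_{i,i-l}`, for a matrix of weights `P`. -/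
noncomputable def expo (P : ℕ → ℕ → ℝ) (i k : ℕ) : ℝ :=
  -P i (i - k) / ∑ l ∈ Finset.range (k + 1), P i (i - l)

/-- The bracket in the recursive definition of `f_k(s, i)`, namely
`G_k(s) = ∑_{b_1,…,b_{k-1}} a_{s,b_1} a_{b_1,b_2} ⋯ a_{b_{k-2},b_{k-1}} a_{b_{k-1}}
  ∏_{c=1}^{k-1} f_c(b_{k-c}, i)` (`a_b` the row sum; `G_1(s) = a_s`),
where `f_c(s, i) = G_c(s) ^ expo P i c`. The sum over `b_1` is written outermost:
`G_{k+1}(s) = ∑_b a_{s,b} f_k(b, i) G_k(b)`. The value at `k = 0` is not used by `f_k`, `k ≥ 1`. -/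
noncomputable def bracket {m : ℕ} (A : Matrix (Fin m) (Fin m) ℝ) (P : ℕ → ℕ → ℝ) (i : ℕ) :
    ℕ → Fin m → ℝ
  | 0, _ => 1
  | 1, s => ∑ j, A s j
  | k + 2, s => ∑ b, A s b * bracket A P i (k + 1) b ^ expo P i (k + 1) * bracket A P i (k + 1) b

/-- `f_k(s, i) = G_k(s) ^ (-P_{i,i-k} / ∑_{l=0}^{k} P_{i,i-l})`. -/
noncomputable def factor {m : ℕ} (A : Matrix (Fin m) (Fin m) ℝ) (P : ℕ → ℕ → ℝ) (i k : ℕ)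
    (s : Fin m) : ℝ :=
  bracket A P i k s ^ expo P i k

/-- `t_{φ;i} = ∑_{j_1,…,j_i} a_{j_1,j_2} ⋯ a_{j_{i-1},j_i} ∏_{k=1}^{i-1} f_k(j_{i-k}, i)`, for
`i ≥ 1`. The letter `j_{d+1}` is `w d`, and `j_{d+1} = j_{i-k}` for `k = i - 1 - d`. -/
noncomputable def tPhi {m : ℕ} (A : Matrix (Fin m) (Fin m) ℝ) (P : ℕ → ℕ → ℝ) (i : ℕ) : ℝ :=
  ∑ w : Fin (i - 1 + 1) → Fin m,
    (∏ d : Fin (i - 1), A (w d.castSucc) (w d.succ)) *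
      ∏ d : Fin (i - 1), factor A P i (i - 1 - d) (w d.castSucc)

/-- `(∑_{j=1}^{i} P_{i,j}) log_m t_{φ;i}`. -/
noncomputable def seriesTerm {m : ℕ} (A : Matrix (Fin m) (Fin m) ℝ) (P : ℕ → ℕ → ℝ) (i : ℕ) : ℝ :=
  (∑ j ∈ Finset.Icc 1 i, P i j) * Real.logb m (tPhi A P i)

end AffineShift

/-! Put `ρ = p/q`. Beyond a threshold, every chain is a strictly increasing orbit of the affine map
`pk + a ↦ qk + b`. A step multiplies the distance to the fixed point by `1/ρ`, so the member at
depth `d` of the chain of `u` is at most `n` exactly for `u` up to about `ρ^d n`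
(`orbit_le_iff_lt_cutoff`, `tendsto_cutoff_div`).

All dimension bounds come from one random point of the shift (`fill`). It copies a fixed admissible
sequence off the chains whose first member is a start, and carries independent Markov words on those
chains, continued deterministically. With weights built from `transfer`, the discounted information
`∑ ρ^d (-log weight_d)` telescopes to the constant `log (partitionSum A ρ i)` on every admissible
word (`sum_pow_mul_neg_log_letterWeight`). If the starts of class `i` have density `β i`, the strong
law gives the `n`-cylinders mass `exp(-n (∑ β i log (partitionSum A ρ i) + o(1)))`, and the mass
distribution principle yields `ofReal_sum_density_mul_logb_le_dimH`.

The rest computes densities. If the gcd does not divide `b - a`, no target is a source, so a start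
has a chain of one or two members. If it does, `displacement` is multiplied by `q₁/p₁` at each step,
so the chain length is read off the power of `p₁` dividing it (`forall_isSource_iff_pow_dvd`). The
resulting `P_{i,j}` make every exponent equal to `ρ - 1`, which identifies `t_{φ;i}` with
`partitionSum A ρ i`; truncating the chain lengths and passing to the limit gives the series. If `p
= 1`, every start has an unbounded chain, and the partition sums converge to `∑ t_i` by Banach's
fixed point theorem in logarithmic coordinates. -/

section

open MeasureTheory ProbabilityTheory
open scoped ENNReal NNReal

/-! ### Mass distribution principle on the symbolic space. -/

namespace SymbolSeq

theorem apply_eq_of_lt_prefixLen {m : ℕ} {x y : SymbolSeq m} {u : ℕ+}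
    (h : (u : ℕ) ≤ prefixLen x y) : x u = y u := by
  have h1 : u.natPred < prefixLen x y := by
    have := u.natPred_add_one
    omega
  have := PiNat.apply_eq_of_lt_firstDiff (E := fun _ => Fin m) h1
  simpa using this

open Classical in
theorem dist_of_ne {m : ℕ} {x y : SymbolSeq m} (h : x ≠ y) :
    dist x y = ((m : ℝ)⁻¹) ^ prefixLen x y := by
  change (if x = y then 0 else ((m : ℝ)⁻¹) ^ prefixLen x y) = _
  rw [if_neg h]

theorem apply_eq_of_dist_le {m : ℕ} (hm : 2 ≤ m) {x y : SymbolSeq m} {n : ℕ}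
    (h : dist x y ≤ ((m : ℝ)⁻¹) ^ n) {u : ℕ+} (hu : (u : ℕ) ≤ n) : x u = y u := by
  by_cases hxy : x = y
  · rw [hxy]
  rw [dist_of_ne hxy] at h
  have h1 : ((m : ℝ)⁻¹) < 1 := inv_lt_one_of_one_lt₀ (by exact_mod_cast hm)
  have h0 : (0 : ℝ) < (m : ℝ)⁻¹ := by
    have : 0 < m := by omega
    positivity
  have := (pow_le_pow_iff_right_of_lt_one₀ h0 h1).1 h
  exact apply_eq_of_lt_prefixLen (hu.trans this)

/-- Mass distribution principle on the symbolic space: if the cylinders around `Φ ω` have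
lower local dimension at least `D` for almost every `ω`, then `D` bounds the Hausdorff dimension
of every set that contains almost every `Φ ω`. -/
theorem ofReal_le_dimH_of_cylinder_le {m : ℕ} (hm : 2 ≤ m) {Ω : Type*} [MeasurableSpace Ω]
    (P : Measure Ω) [IsProbabilityMeasure P] (Φ : Ω → SymbolSeq m) (X : Set (SymbolSeq m)) (D : ℝ)
    (hX : ∀ᵐ ω ∂P, Φ ω ∈ X)
    (h : ∀ᵐ ω ∂P, ∀ D' < D, ∀ᶠ n : ℕ in atTop,
      P {ω' | ∀ u : ℕ+, (u : ℕ) ≤ n → Φ ω' u = Φ ω u} ≤ ENNReal.ofReal ((m : ℝ) ^ (-(D' * n)))) :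
    ENNReal.ofReal D ≤ dimH X := by
  have hm0 : (0 : ℝ) < m := by
    have : 0 < m := by omega
    positivity
  have hm1 : (1 : ℝ) < m := by exact_mod_cast hm
  refine le_of_forall_lt fun c hc => ?_
  obtain ⟨d, hcd, hdD⟩ := ENNReal.lt_iff_exists_nnreal_btwn.1 hc
  refine hcd.trans_le ?_
  have hd0 : (0 : ℝ) < d := by
    have : (0 : ℝ≥0∞) < d := (zero_le).trans_lt hcd
    exact_mod_cast this
  have hdD' : (d : ℝ) < D := by
    have := (ENNReal.lt_ofReal_iff_toReal_lt ENNReal.coe_ne_top).1 hdD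
    simpa using this
  let _ : MeasurableSpace (SymbolSeq m) := borel _
  have : BorelSpace (SymbolSeq m) := ⟨rfl⟩
  apply le_dimH_of_hausdorffMeasure_ne_zero
  let cyl : ℕ → Ω → Set Ω := fun n ω => {ω' | ∀ u : ℕ+, (u : ℕ) ≤ n → Φ ω' u = Φ ω u}
  -- The exponent `n + 1` anticipates the covering step: a set of diameter between `m^(-(n+1))` and
  -- `m^(-n)` lies in an `n`-cylinder.
  let G : ℕ → Set Ω := fun N =>
    {ω | Φ ω ∈ X ∧ ∀ n ≥ N, P (cyl n ω) ≤ ENNReal.ofReal (((m : ℝ)⁻¹ ^ (n + 1)) ^ (d : ℝ))}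
  have hG : ∀ᵐ ω ∂P, ω ∈ ⋃ N, G N := by
    filter_upwards [hX, h] with ω h1 h2
    -- The midpoint leaves slack `(D - d)/2 * n`, which eventually absorbs the factor `m^(-d)` lost
    -- in passing from `n` to `n + 1`.
    have h3 := h2 (((d : ℝ) + D) / 2) (by linarith)
    have h4 : ∀ᶠ n : ℕ in atTop, (d : ℝ) / ((D - d) / 2) ≤ n :=
      tendsto_natCast_atTop_atTop.eventually_ge_atTop _
    obtain ⟨N, hN⟩ := eventually_atTop.1 (h3.and h4)
    refine Set.mem_iUnion.2 ⟨N, h1, fun n hn => (hN n hn).1.trans ?_⟩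
    apply ENNReal.ofReal_le_ofReal
    have h5 := (hN n hn).2
    rw [div_le_iff₀ (by linarith)] at h5
    rw [← Real.rpow_natCast, Real.inv_rpow hm0.le, ← Real.rpow_neg hm0.le, ← Real.rpow_mul hm0.le]
    apply Real.rpow_le_rpow_of_exponent_le hm1.le
    push_cast
    nlinarith
  obtain ⟨N, hN⟩ : ∃ N, P (G N) ≠ 0 := by
    by_contra! H
    have h1 : P (⋃ N, G N) = 0 := measure_iUnion_null H
    have h2 : ∀ᵐ ω ∂P, ω ∉ ⋃ N, G N := measure_eq_zero_iff_ae_notMem.1 h1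
    have h3 : ∀ᵐ ω ∂P, False := by
      filter_upwards [hG, h2] with ω a b using b a
    have h4 := IsProbabilityMeasure.measure_univ (μ := P)
    simp at h3
    rw [h3] at h4
    simp at h4
  -- Working with outer measures avoids any measurability of `Φ` or of `G N`.
  let μ : OuterMeasure (SymbolSeq m) :=
    OuterMeasure.map Φ (OuterMeasure.restrict (G N) P.toOuterMeasure)
  have hμs : ∀ s, μ s = P (Φ ⁻¹' s ∩ G N) := fun s => by
    simp [μ]
  have key : ∀ (s : Set (SymbolSeq m)) (n : ℕ), N ≤ n →
      Metric.ediam s ≤ ENNReal.ofReal ((m : ℝ)⁻¹ ^ n) →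
      μ s ≤ ENNReal.ofReal (((m : ℝ)⁻¹ ^ (n + 1)) ^ (d : ℝ)) := by
    intro s n hn hs
    rw [hμs]
    by_cases hne : (Φ ⁻¹' s ∩ G N).Nonempty
    · obtain ⟨ω, hω1, hω2⟩ := hne
      refine le_trans (measure_mono ?_) (hω2.2 n hn)
      rintro ω' ⟨hω', -⟩ u hu
      apply apply_eq_of_dist_le hm _ hu
      have := (Metric.edist_le_ediam_of_mem (show Φ ω' ∈ s from hω') (show Φ ω ∈ s from hω1)).trans hs
      rw [edist_dist] at this
      exact (ENNReal.ofReal_le_ofReal_iff (by positivity)).1 this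
    · rw [Set.not_nonempty_iff_eq_empty.1 hne]
      simp
  have hle : μ ≤ OuterMeasure.mkMetric (fun r => r ^ (d : ℝ)) := by
    refine OuterMeasure.le_mkMetric _ μ (ENNReal.ofReal ((m : ℝ)⁻¹ ^ N)) (by
      rw [ENNReal.ofReal_pos]; positivity) fun s hs => ?_
    have hi1 : ((m : ℝ)⁻¹) < 1 := inv_lt_one_of_one_lt₀ (by exact_mod_cast hm)
    have hi0 : (0 : ℝ) < (m : ℝ)⁻¹ := by positivity
    -- A set of diameter zero lies in cylinders of every length, so its mass is zero.
    by_cases hzero : Metric.ediam s = 0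
    · have : ∀ n, N ≤ n → μ s ≤ ENNReal.ofReal (((m : ℝ)⁻¹ ^ (n + 1)) ^ (d : ℝ)) :=
        fun n hn => key s n hn (by rw [hzero]; exact zero_le)
      have hlim : Tendsto (fun n : ℕ => ENNReal.ofReal (((m : ℝ)⁻¹ ^ (n + 1)) ^ (d : ℝ))) atTop
          (𝓝 0) := by
        rw [← ENNReal.ofReal_zero]
        apply ENNReal.tendsto_ofReal
        have h1 := (tendsto_pow_atTop_nhds_zero_of_lt_one hi0.le hi1).comp (tendsto_add_atTop_nat 1)
        have h2 := h1.rpow_const (p := (d : ℝ)) (Or.inr hd0.le)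
        rw [Real.zero_rpow hd0.ne'] at h2
        exact h2
      have : μ s ≤ 0 := ge_of_tendsto hlim (eventually_atTop.2 ⟨N, this⟩)
      exact this.trans zero_le
    · have hfin : Metric.ediam s ≠ ⊤ := (hs.trans_lt ENNReal.ofReal_lt_top).ne
      set e := (Metric.ediam s).toReal with he
      have he0 : 0 < e := ENNReal.toReal_pos hzero hfin
      have heq : Metric.ediam s = ENNReal.ofReal e := (ENNReal.ofReal_toReal hfin).symm
      have heN : e ≤ (m : ℝ)⁻¹ ^ N := by
        rw [heq] at hs
        exact (ENNReal.ofReal_le_ofReal_iff (by positivity)).1 hs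
      obtain ⟨n, hn1, hn2⟩ := exists_nat_pow_near_of_lt_one he0
        (heN.trans (pow_le_one₀ hi0.le hi1.le)) hi0 hi1
      have hNn : N ≤ n := by
        have := hn1.trans_le heN
        have := (pow_lt_pow_iff_right_of_lt_one₀ hi0 hi1).1 this
        omega
      refine (key s n hNn (by rw [heq]; exact ENNReal.ofReal_le_ofReal hn2)).trans ?_
      rw [heq, ENNReal.ofReal_rpow_of_pos he0]
      exact ENNReal.ofReal_le_ofReal (Real.rpow_le_rpow (by positivity) hn1.le hd0.le)
  have hfinal : P (G N) ≤ μH[(d : ℝ)] X := by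
    have h1 : μ X ≤ (OuterMeasure.mkMetric (fun r => r ^ (d : ℝ)) : OuterMeasure (SymbolSeq m)) X :=
      hle X
    rw [hμs] at h1
    have h2 : (Φ ⁻¹' X ∩ G N) = G N := Set.inter_eq_right.2 fun ω hω => hω.1
    rw [h2, ← Measure.mkMetric_toOuterMeasure] at h1
    exact h1
  intro h0
  rw [h0] at hfinal
  exact hN (le_antisymm hfinal zero_le)

end SymbolSeq

/-! ### Densities and the strong law along a set of indices. -/

/-- The set `B` of natural numbers has asymptotic density `β`. -/
def HasDensity (B : Set ℕ) (β : ℝ) : Prop :=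
  Tendsto (fun n : ℕ => (∑ u ∈ Finset.range n, B.indicator (fun _ => (1 : ℝ)) u) / n)
    atTop (𝓝 β)

open Classical in
theorem sum_indicator_range_eq_sum_nth (B : Set ℕ) (f : ℕ → ℝ) (n : ℕ) :
    ∑ u ∈ Finset.range n, B.indicator f u
      = ∑ k ∈ Finset.range (Nat.count (· ∈ B) n), f (Nat.nth (· ∈ B) k) := by
  induction n with
  | zero => simp
  | succ n ih =>
    rw [Finset.sum_range_succ, ih, Nat.count_succ]
    by_cases h : n ∈ B
    · rw [if_pos h, Finset.sum_range_succ, Nat.nth_count (p := (· ∈ B)) h, Set.indicator_of_mem h]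
    · rw [if_neg h, Set.indicator_of_notMem h]
      simp

open Classical in
theorem sum_indicator_one_range (B : Set ℕ) (n : ℕ) :
    ∑ u ∈ Finset.range n, B.indicator (fun _ => (1 : ℝ)) u = Nat.count (· ∈ B) n := by
  rw [sum_indicator_range_eq_sum_nth]
  simp

/-- Strong law of large numbers along a set of indices with a density. -/
theorem strong_law_along_density {W : Type*} [Finite W] [MeasurableSpace W]
    [DiscreteMeasurableSpace W] (ν : ℕ → Measure W) [∀ u, IsProbabilityMeasure (ν u)]
    (ν₀ : Measure W) [IsProbabilityMeasure ν₀] (B : Set ℕ) (hB : ∀ u ∈ B, ν u = ν₀) {β : ℝ} (hβ : HasDensity B β)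
    (h : W → ℝ) :
    ∀ᵐ ω ∂(Measure.infinitePi ν), Tendsto
      (fun n : ℕ => (∑ u ∈ Finset.range n, B.indicator (fun v => h (ω v)) u) / n) atTop
      (𝓝 (β * ∫ w, h w ∂ν₀)) := by
  classical
  have hm : Measurable h := Measurable.of_discrete
  unfold HasDensity at hβ
  simp only [sum_indicator_one_range] at hβ
  by_cases hfin : B.Finite
  · have hβ0 : β = 0 := by
      refine tendsto_nhds_unique hβ ?_
      refine squeeze_zero (g := fun n : ℕ => (hfin.toFinset.card : ℝ) / n) (fun n => by positivity)
        (fun n => ?_) (tendsto_const_div_atTop_nhds_zero_nat _)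
      gcongr
      exact Nat.count_le_card (p := (· ∈ B)) hfin n
    refine Eventually.of_forall fun ω => ?_
    rw [hβ0, zero_mul]
    have hev : ∀ᶠ n : ℕ in atTop,
        (∑ u ∈ hfin.toFinset, B.indicator (fun v => h (ω v)) u) / n
          = (∑ u ∈ Finset.range n, B.indicator (fun v => h (ω v)) u) / n := by
      obtain ⟨M, hM⟩ := hfin.bddAbove
      filter_upwards [eventually_gt_atTop M] with n hn
      congr 1
      refine Finset.sum_subset (fun u hu => ?_) (fun u _ hu => ?_)
      · exact Finset.mem_range.2 ((hM (hfin.mem_toFinset.1 hu)).trans_lt hn)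
      · rw [Set.indicator_of_notMem]
        simpa using hu
    exact (tendsto_const_div_atTop_nhds_zero_nat _).congr' hev
  · have hinf : B.Infinite := hfin
    have hmem : ∀ k, Nat.nth (· ∈ B) k ∈ B := fun k => Nat.nth_mem_of_infinite hinf k
    have hinj : Function.Injective (Nat.nth (· ∈ B)) := Nat.nth_injective hinf
    -- Enumerating `B` gives an i.i.d. sequence. The average sought is its ordinary average at time
    -- `Nat.count`, multiplied by the proportion of `B` below `n`.
    let X : ℕ → (ℕ → W) → ℝ := fun k ω => h (ω (Nat.nth (· ∈ B) k))
    have hmX : ∀ k, Measurable (X k) := fun k => hm.comp (measurable_pi_apply _)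
    have hmap : ∀ k, (Measure.infinitePi ν).map (X k) = ν₀.map h := by
      intro k
      have h1 : X k = h ∘ (fun ω : ℕ → W => ω (Nat.nth (· ∈ B) k)) := rfl
      rw [h1, ← Measure.map_map hm (measurable_pi_apply _), Measure.infinitePi_map_eval,
        hB _ (hmem k)]
    have hind : iIndepFun (fun u (ω : ℕ → W) => h (ω u)) (Measure.infinitePi ν) :=
      iIndepFun_infinitePi (X := fun _ => h) (fun _ => hm)
    have hlaw := strong_law_ae_real X (μ := Measure.infinitePi ν)
      (by
        obtain ⟨C, hC⟩ := (Set.finite_range (fun w => ‖h w‖)).bddAbove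
        exact Integrable.of_bound (hmX 0).aestronglyMeasurable C
          (Eventually.of_forall fun ω => hC ⟨_, rfl⟩))
      (fun k l hkl => hind.indepFun (hinj.ne hkl))
      (fun k => ⟨(hmX k).aemeasurable, (hmX 0).aemeasurable, by rw [hmap, hmap]⟩)
    have hE : ∫ ω, X 0 ω ∂(Measure.infinitePi ν) = ∫ w, h w ∂ν₀ := by
      have h1 := integral_map (μ := Measure.infinitePi ν) (hmX 0).aemeasurable
        (f := fun x : ℝ => x) (by fun_prop)
      have h2 := integral_map (μ := ν₀) hm.aemeasurable (f := fun x : ℝ => x) (by fun_prop)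
      rw [← h1, hmap, h2]
    have hC : Tendsto (Nat.count (· ∈ B)) atTop atTop :=
      tendsto_atTop_atTop_of_monotone (Nat.count_monotone (· ∈ B)) fun k =>
        ⟨Nat.nth (· ∈ B) k, (Nat.count_nth_of_infinite (p := (· ∈ B)) hinf k).ge⟩
    filter_upwards [hlaw] with ω hω
    rw [hE] at hω
    refine ((hω.comp hC).mul hβ |>.congr' ?_).trans (by rw [mul_comm])
    filter_upwards [hC.eventually_gt_atTop 0] with n hn
    have hn' : ((Nat.count (· ∈ B) n : ℕ) : ℝ) ≠ 0 := by positivity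
    rw [sum_indicator_range_eq_sum_nth]
    simp only [Function.comp, X]
    field_simp

/-! ### Measures on finite words with given conditional weights. -/

section ConditionalWeights

variable {S : Type*} [Fintype S] [DecidableEq S] {n : ℕ} {T : ℕ → (Fin n → S) → ℝ}

/-- Summing out the last free letter leaves the shorter product, because its conditional weight sums
to one and the earlier weights do not see it. The induction is on the number `k = n - j` of free
letters. -/
theorem sum_prefix_prod_conditional
    (hloc : ∀ d < n, ∀ w w' : Fin n → S, (∀ e : Fin n, (e : ℕ) ≤ d → w e = w' e) → T d w = T d w')
    (hsum : ∀ (d : ℕ) (h : d < n) (w : Fin n → S), ∑ b, T d (Function.update w ⟨d, h⟩ b) = 1)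
    (k : ℕ) : ∀ (j : ℕ), j + k = n → ∀ w : Fin n → S,
    (∑ w' : Fin n → S, if (∀ e : Fin n, (e : ℕ) < j → w' e = w e) then
      ∏ d ∈ Finset.range n, T d w' else 0) = ∏ d ∈ Finset.range j, T d w := by
  induction k with
  | zero =>
    intro j hj w
    obtain rfl : j = n := by omega
    have : ∀ w' : Fin j → S, (∀ e : Fin j, (e : ℕ) < j → w' e = w e) ↔ w' = w := fun w' =>
      ⟨fun h => funext fun e => h e e.2, fun h e _ => by rw [h]⟩
    simp only [this]
    simp
  | succ k ih =>
    intro j hj w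
    have hjn : j < n := by omega
    have hsplit : ∀ w' : Fin n → S,
        (if (∀ e : Fin n, (e : ℕ) < j → w' e = w e) then ∏ d ∈ Finset.range n, T d w' else 0)
        = ∑ b, if (∀ e : Fin n, (e : ℕ) < j + 1 → w' e = Function.update w ⟨j, hjn⟩ b e) then
          ∏ d ∈ Finset.range n, T d w' else 0 := by
      intro w'
      have hiff : ∀ b, (∀ e : Fin n, (e : ℕ) < j + 1 → w' e = Function.update w ⟨j, hjn⟩ b e) ↔
          b = w' ⟨j, hjn⟩ ∧ ∀ e : Fin n, (e : ℕ) < j → w' e = w e := by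
        intro b
        constructor
        · intro h
          refine ⟨by simpa using (h ⟨j, hjn⟩ (by simp)).symm, fun e he => ?_⟩
          have := h e (by omega)
          rwa [Function.update_of_ne (by intro hh; rw [hh] at he; simp at he)] at this
        · rintro ⟨rfl, h⟩ e he
          by_cases hej : e = ⟨j, hjn⟩
          · subst hej; simp
          · rw [Function.update_of_ne hej]
            refine h e ?_
            have : (e : ℕ) ≠ j := fun hh => hej (Fin.ext hh)
            omega
      simp only [hiff]
      by_cases hc : ∀ e : Fin n, (e : ℕ) < j → w' e = w e
      · rw [if_pos hc]
        simp only [and_iff_left hc]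
        simp
      · simp only [hc, and_false, if_false, Finset.sum_const_zero]
    rw [Finset.sum_congr rfl fun w' _ => hsplit w', Finset.sum_comm]
    rw [Finset.sum_congr rfl fun b _ => ih (j + 1) (by omega) (Function.update w ⟨j, hjn⟩ b)]
    simp only [Finset.prod_range_succ]
    rw [Finset.sum_congr rfl (g := fun b => (∏ d ∈ Finset.range j, T d w) *
      T j (Function.update w ⟨j, hjn⟩ b)), ← Finset.mul_sum, hsum, mul_one]
    intro b _
    congr 1
    refine Finset.prod_congr rfl fun d hd => hloc d ?_ _ _ fun e he => ?_
    · have := Finset.mem_range.1 hd; omega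
    · rw [Function.update_of_ne]
      intro hh
      have := Finset.mem_range.1 hd
      rw [hh] at he
      simp at he
      omega

/-- A probability measure on words of length `n` with prescribed conditional weights. -/
theorem exists_measure_of_conditional [MeasurableSpace S] [MeasurableSingletonClass S]
    (h0 : ∀ d < n, ∀ w, 0 ≤ T d w)
    (hloc : ∀ d < n, ∀ w w' : Fin n → S, (∀ e : Fin n, (e : ℕ) ≤ d → w e = w' e) → T d w = T d w')
    (hsum : ∀ (d : ℕ) (h : d < n) (w : Fin n → S), ∑ b, T d (Function.update w ⟨d, h⟩ b) = 1)
    [Nonempty S] :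
    ∃ ν : Measure (Fin n → S), IsProbabilityMeasure ν ∧
      (∀ j ≤ n, ∀ w, ν {w' | ∀ e : Fin n, (e : ℕ) < j → w' e = w e}
        = ENNReal.ofReal (∏ d ∈ Finset.range j, T d w)) ∧
      ∀ᵐ w ∂ν, ∀ d < n, 0 < T d w := by
  have hpos : ∀ w, 0 ≤ ∏ d ∈ Finset.range n, T d w := fun w =>
    Finset.prod_nonneg fun d hd => h0 d (Finset.mem_range.1 hd) w
  have hone : ∑ w : Fin n → S, ENNReal.ofReal (∏ d ∈ Finset.range n, T d w) = 1 := by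
    rw [← ENNReal.ofReal_sum_of_nonneg fun w _ => hpos w]
    have := sum_prefix_prod_conditional hloc hsum n 0 (by omega) (fun _ => Classical.arbitrary S)
    simp only [not_lt_zero, false_imp_iff, implies_true, if_true, Finset.range_zero,
      Finset.prod_empty] at this
    rw [this, ENNReal.ofReal_one]
  let μ : PMF (Fin n → S) := PMF.ofFintype _ hone
  refine ⟨μ.toMeasure, inferInstance, fun j hj w => ?_, ?_⟩
  · rw [PMF.toMeasure_apply_fintype, ← sum_prefix_prod_conditional hloc hsum (n - j) j (by omega) w,
      ENNReal.ofReal_sum_of_nonneg]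
    · refine Finset.sum_congr rfl fun w' _ => ?_
      by_cases hc : ∀ e : Fin n, (e : ℕ) < j → w' e = w e
      · rw [if_pos hc, Set.indicator_of_mem (by exact hc)]
        rfl
      · rw [if_neg hc, Set.indicator_of_notMem (by exact hc)]
        simp
    · intro w' _
      split_ifs
      · exact hpos w'
      · exact le_rfl
  · rw [ae_iff, PMF.toMeasure_apply_fintype]
    refine Finset.sum_eq_zero fun w _ => ?_
    by_cases hw : ∀ d < n, 0 < T d w
    · rw [Set.indicator_of_notMem (by simpa using hw)]
    · rw [Set.indicator_of_mem (by exact hw)]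
      push Not at hw
      obtain ⟨d, hd, hdw⟩ := hw
      change ENNReal.ofReal (∏ d ∈ Finset.range n, T d w) = 0
      rw [Finset.prod_eq_zero (Finset.mem_range.2 hd) (le_antisymm hdw (h0 d hd w)),
        ENNReal.ofReal_zero]

end ConditionalWeights

/-! ### The optimal Markov weights on a chain. -/

namespace AffineShift

variable {m : ℕ}

/-- Iterated transfer sums `G₀ = 1`, `G_{k+1}(s) = ∑_b a_{s,b} G_k(b) ^ ρ`. -/
noncomputable def transfer (A : Matrix (Fin m) (Fin m) ℝ) (ρ : ℝ) : ℕ → Fin m → ℝ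
  | 0, _ => 1
  | k + 1, s => ∑ b, A s b * transfer A ρ k b ^ ρ

/-- The partition sum `∑_b G_{i-1}(b) ^ ρ` of words of length `i`. -/
noncomputable def partitionSum (A : Matrix (Fin m) (Fin m) ℝ) (ρ : ℝ) (i : ℕ) : ℝ :=
  ∑ b, transfer A ρ (i - 1) b ^ ρ

variable {A : Matrix (Fin m) (Fin m) ℝ} {ρ : ℝ}

theorem one_le_transfer (hbin : ∀ i j, A i j = 0 ∨ A i j = 1) (hrow : ∀ i, ∃ j, A i j = 1)
    (hρ : 0 ≤ ρ) (k : ℕ) (s : Fin m) : 1 ≤ transfer A ρ k s := by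
  induction k generalizing s with
  | zero => exact le_rfl
  | succ k ih =>
    obtain ⟨j, hj⟩ := hrow s
    have h1 : 1 ≤ A s j * transfer A ρ k j ^ ρ := by
      rw [hj, one_mul]
      exact Real.one_le_rpow (ih j) hρ
    refine h1.trans (Finset.single_le_sum (f := fun b => A s b * transfer A ρ k b ^ ρ)
      (fun b _ => ?_) (Finset.mem_univ j))
    have : 0 ≤ A s b := by rcases hbin s b with h | h <;> simp [h]
    have := (zero_le_one.trans (ih b))
    positivity

theorem le_partitionSum (hbin : ∀ i j, A i j = 0 ∨ A i j = 1) (hrow : ∀ i, ∃ j, A i j = 1)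
    (hρ : 0 ≤ ρ) (i : ℕ) : (m : ℝ) ≤ partitionSum A ρ i := by
  calc (m : ℝ) = ∑ _b : Fin m, (1 : ℝ) := by simp
    _ ≤ _ := Finset.sum_le_sum fun b _ => Real.one_le_rpow (one_le_transfer hbin hrow hρ _ b) hρ

/-- Conditional weight of the `d`-th letter of a word of which the first `i` letters are random
and the others follow the successor map `σ`. -/
noncomputable def letterWeight (A : Matrix (Fin m) (Fin m) ℝ) (ρ : ℝ) (σ : Fin m → Fin m)
    (z : Fin m) (i : ℕ) : ℕ → (ℕ → Fin m) → ℝ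
  | 0, x => if 0 < i then transfer A ρ (i - 1) (x 0) ^ ρ / partitionSum A ρ i
      else if x 0 = z then 1 else 0
  | d + 1, x => if d + 1 < i then
      A (x d) (x (d + 1)) * transfer A ρ (i - 1 - (d + 1)) (x (d + 1)) ^ ρ
        / transfer A ρ (i - 1 - d) (x d)
      else if x (d + 1) = σ (x d) then 1 else 0

/-- Extension of a finite word to an infinite one along the successor map `σ`. -/
def extend (σ : Fin m → Fin m) (z : Fin m) {n : ℕ} (w : Fin n → Fin m) : ℕ → Fin m
  | 0 => if h : 0 < n then w ⟨0, h⟩ else z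
  | d + 1 => if h : d + 1 < n then w ⟨d + 1, h⟩ else σ (extend σ z w d)

theorem extend_of_lt (σ : Fin m → Fin m) (z : Fin m) {n : ℕ} (w : Fin n → Fin m) {d : ℕ}
    (h : d < n) : extend σ z w d = w ⟨d, h⟩ := by
  cases d <;> rw [extend, dif_pos h]

theorem letterWeight_nonneg (hbin : ∀ i j, A i j = 0 ∨ A i j = 1) (hrow : ∀ i, ∃ j, A i j = 1)
    (hρ : 0 ≤ ρ) (σ : Fin m → Fin m) (z : Fin m) (i d : ℕ) (x : ℕ → Fin m) :
    0 ≤ letterWeight A ρ σ z i d x := by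
  have hG : ∀ k s, 0 ≤ transfer A ρ k s := fun k s =>
    zero_le_one.trans (one_le_transfer hbin hrow hρ k s)
  have ht : 0 ≤ partitionSum A ρ i := (Nat.cast_nonneg m).trans (le_partitionSum hbin hrow hρ i)
  cases d with
  | zero =>
    rw [letterWeight]
    split_ifs
    · exact div_nonneg (Real.rpow_nonneg (hG _ _) _) ht
    · exact zero_le_one
    · exact le_rfl
  | succ d =>
    rw [letterWeight]
    have : 0 ≤ A (x d) (x (d + 1)) := by rcases hbin (x d) (x (d + 1)) with h | h <;> simp [h]
    split_ifs
    · exact div_nonneg (mul_nonneg this (Real.rpow_nonneg (hG _ _) _)) (hG _ _)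
    · exact zero_le_one
    · exact le_rfl

theorem letterWeight_congr (σ : Fin m → Fin m) (z : Fin m) (i d : ℕ) {x y : ℕ → Fin m}
    (h : ∀ e ≤ d, x e = y e) : letterWeight A ρ σ z i d x = letterWeight A ρ σ z i d y := by
  cases d with
  | zero => simp only [letterWeight, h 0 le_rfl]
  | succ d => simp only [letterWeight, h (d + 1) le_rfl, h d (Nat.le_succ d)]

/-- The denominators are exactly the sums defining `transfer` and `partitionSum`; the deterministic
letters put all mass on one symbol. -/
theorem sum_letterWeight (hbin : ∀ i j, A i j = 0 ∨ A i j = 1) (hrow : ∀ i, ∃ j, A i j = 1)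
    (hρ : 0 ≤ ρ) (hm : 0 < m) (σ : Fin m → Fin m) (z : Fin m) (i d : ℕ) (x : ℕ → Fin m) :
    ∑ b, letterWeight A ρ σ z i d (Function.update x d b) = 1 := by
  cases d with
  | zero =>
    simp only [letterWeight, Function.update_self]
    split_ifs with h
    · rw [← Finset.sum_div]
      refine div_self (ne_of_gt ?_)
      exact (Nat.cast_pos.2 hm).trans_le (le_partitionSum hbin hrow hρ i)
    · simp
  | succ d =>
    have hne : d ≠ d + 1 := by omega
    simp only [letterWeight, Function.update_self, Function.update_of_ne hne]
    split_ifs with h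
    · rw [← Finset.sum_div]
      have h1 : i - 1 - d = i - 1 - (d + 1) + 1 := by omega
      rw [h1, transfer]
      refine div_self (ne_of_gt ?_)
      exact zero_lt_one.trans_le (one_le_transfer hbin hrow hρ (i - 1 - (d + 1) + 1) (x d))
    · simp

theorem apply_eq_one_of_letterWeight_pos (hbin : ∀ i j, A i j = 0 ∨ A i j = 1)
    {σ : Fin m → Fin m} (hσ : ∀ s, A s (σ s) = 1) {z : Fin m} {i d : ℕ} {x : ℕ → Fin m}
    (h : 0 < letterWeight A ρ σ z i (d + 1) x) : A (x d) (x (d + 1)) = 1 := by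
  rw [letterWeight] at h
  split_ifs at h with h1 h2
  · rcases hbin (x d) (x (d + 1)) with h3 | h3
    · simp [h3] at h
    · exact h3
  · rw [h2, hσ]
  · exact absurd h (lt_irrefl _)

/-- Each letter contributes a denominator `G_k` at the previous letter and a numerator `G_{k-1}^ρ`
at its own. After weighting by `ρ^d`, the numerator of one letter cancels the denominator of the
next, and the last numerator is `G_0 = 1`. That the value does not depend on the word is what makes
these weights optimal. -/
theorem sum_pow_mul_neg_log_letterWeight (hbin : ∀ i j, A i j = 0 ∨ A i j = 1)
    (hrow : ∀ i, ∃ j, A i j = 1) (hρ : 0 ≤ ρ) (hm : 0 < m) (σ : Fin m → Fin m) (z : Fin m)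
    {i : ℕ} (hi : 1 ≤ i) {x : ℕ → Fin m} (hx : ∀ d, d + 1 < i → A (x d) (x (d + 1)) = 1) :
    ∑ d ∈ Finset.range i, ρ ^ d * -Real.log (letterWeight A ρ σ z i d x)
      = Real.log (partitionSum A ρ i) := by
  have hG : ∀ k s, 0 < transfer A ρ k s := fun k s =>
    zero_lt_one.trans_le (one_le_transfer hbin hrow hρ k s)
  have ht : 0 < partitionSum A ρ i := (Nat.cast_pos.2 hm).trans_le (le_partitionSum hbin hrow hρ i)
  have key : ∀ n, n + 1 ≤ i →
      ∑ d ∈ Finset.range (n + 1), ρ ^ d * -Real.log (letterWeight A ρ σ z i d x)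
        = Real.log (partitionSum A ρ i)
          - ρ ^ (n + 1) * Real.log (transfer A ρ (i - 1 - n) (x n)) := by
    intro n
    induction n with
    | zero =>
      intro _
      rw [Finset.sum_range_one, letterWeight, if_pos (by omega),
        Real.log_div (Real.rpow_pos_of_pos (hG _ _) _).ne' ht.ne', Real.log_rpow (hG _ _)]
      simp
    | succ n ih =>
      intro hn
      rw [Finset.sum_range_succ, ih (by omega), letterWeight, if_pos (by omega), hx n (by omega),
        one_mul, Real.log_div (Real.rpow_pos_of_pos (hG _ _) _).ne' (hG _ _).ne',
        Real.log_rpow (hG _ _)]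
      ring
  obtain ⟨n, rfl⟩ : ∃ n, i = n + 1 := ⟨i - 1, by omega⟩
  rw [key n le_rfl]
  simp [transfer]

/-- The Markov measure on words of length `n` with the conditional weights `letterWeight`. -/
theorem exists_wordMeasure (hbin : ∀ i j, A i j = 0 ∨ A i j = 1) (hrow : ∀ i, ∃ j, A i j = 1)
    (hρ : 0 ≤ ρ) (hm : 0 < m) {σ : Fin m → Fin m} (hσ : ∀ s, A s (σ s) = 1) (z : Fin m) (n i : ℕ) :
    ∃ ν : Measure (Fin n → Fin m), IsProbabilityMeasure ν ∧
      (∀ j ≤ n, ∀ w, ν {w' | ∀ e : Fin n, (e : ℕ) < j → w' e = w e}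
        = ENNReal.ofReal (∏ d ∈ Finset.range j, letterWeight A ρ σ z i d (extend σ z w))) ∧
      ∀ᵐ w ∂ν, (∀ d < n, 0 < letterWeight A ρ σ z i d (extend σ z w)) ∧
        ∀ d, A (extend σ z w d) (extend σ z w (d + 1)) = 1 := by
  have : Nonempty (Fin m) := ⟨z⟩
  obtain ⟨ν, h1, h2, h3⟩ := exists_measure_of_conditional (n := n) (S := Fin m)
    (T := fun d w => letterWeight A ρ σ z i d (extend σ z w))
    (fun d _ w => letterWeight_nonneg hbin hrow hρ σ z i d _)
    (fun d hd w w' h => letterWeight_congr σ z i d fun e he => by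
      rw [extend_of_lt σ z w (by omega : e < n), extend_of_lt σ z w' (by omega : e < n)]
      exact h _ he)
    (fun d hd w => by
      rw [← sum_letterWeight hbin hrow hρ hm σ z i d (extend σ z w)]
      refine Finset.sum_congr rfl fun b _ => letterWeight_congr σ z i d fun e he => ?_
      rw [extend_of_lt _ _ _ (by omega : e < n)]
      by_cases hed : e = d
      · subst hed; simp
      · rw [Function.update_of_ne (by simpa using hed), Function.update_of_ne hed,
          extend_of_lt _ _ _ (by omega : e < n)])
  refine ⟨ν, h1, h2, ?_⟩
  filter_upwards [h3] with w hw
  refine ⟨hw, fun d => ?_⟩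
  by_cases hd : d + 1 < n
  · exact apply_eq_one_of_letterWeight_pos hbin hσ (hw (d + 1) hd)
  · rw [extend, dif_neg hd, hσ]

end AffineShift

theorem tendsto_div_natCast_of_abs_sub_le {f : ℕ → ℝ} {κ C : ℝ} (h : ∀ n : ℕ, |f n - κ * n| ≤ C) :
    Tendsto (fun n : ℕ => f n / n) atTop (𝓝 κ) := by
  rw [tendsto_iff_norm_sub_tendsto_zero]
  refine squeeze_zero' (g := fun n : ℕ => C / n) (Eventually.of_forall fun n => norm_nonneg _) ?_
    (tendsto_const_div_atTop_nhds_zero_nat C)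
  filter_upwards [eventually_gt_atTop 0] with n hn
  have hn' : (0 : ℝ) < n := Nat.cast_pos.2 hn
  have : f n / n - κ = (f n - κ * n) / n := by field_simp
  rw [this, Real.norm_eq_abs, abs_div, abs_of_pos hn']
  gcongr
  exact h n

/-- Applied to increasing orbits: the depths of the members at most `n` form an initial segment. -/
theorem exists_filter_range_eq_range (P : ℕ → Prop) [DecidablePred P] (c : ℕ)
    (hP : ∀ d e, d ≤ e → e < c → P e → P d) :
    ∃ j ≤ c, (Finset.range c).filter P = Finset.range j := by
  induction c with
  | zero => exact ⟨0, le_rfl, by simp⟩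
  | succ c ih =>
    by_cases h : P c
    · refine ⟨c + 1, le_rfl, ?_⟩
      refine Finset.filter_true_of_mem fun d hd => ?_
      exact hP d c (by have := Finset.mem_range.1 hd; omega) (Nat.lt_succ_self c) h
    · obtain ⟨j, hj, hf⟩ := ih fun d e hde he => hP d e hde (by omega)
      refine ⟨j, by omega, ?_⟩
      rw [Finset.range_add_one, Finset.filter_insert, if_neg h, hf]

/-! ### Chains as orbits of an affine map. -/

namespace AffineShift

/-- Integers that are the first index `pk + a` of some constraint. -/
def IsSource (p : ℕ) (a z : ℤ) : Prop := (p : ℤ) ∣ z - a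

/-- Integers that are the second index `qk + b` of some constraint. -/
def IsTarget (q : ℕ) (b z : ℤ) : Prop := (q : ℤ) ∣ z - b

/-- The map `pk + a ↦ qk + b`. -/
def next (p q : ℕ) (a b z : ℤ) : ℤ := q * ((z - a) / p) + b

/-- From this position on, chains are strictly increasing and all indices are positive. -/
def threshold (q : ℕ) (a b : ℤ) : ℤ := q * (2 + |a| + |b|)

/-- First members of the chains that lie beyond the threshold. -/
def IsStart (q : ℕ) (a b z : ℤ) : Prop := threshold q a b ≤ z ∧ ¬ IsTarget q b z

/-- The `d`-th member of the chain that starts at `z`. -/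
def orbit (p q : ℕ) (a b : ℤ) (d : ℕ) (z : ℤ) : ℤ := (next p q a b)^[d] z

/-- `v` is the `d`-th member of the chain that starts at `u`. -/
def IsMember (p q : ℕ) (a b : ℤ) (u : ℤ) (d : ℕ) (v : ℤ) : Prop :=
  (∀ e < d, IsSource p a (orbit p q a b e u)) ∧ orbit p q a b d u = v

variable {p q : ℕ} {a b : ℤ}

theorem orbit_zero (z : ℤ) : orbit p q a b 0 z = z := rfl

theorem orbit_succ (d : ℕ) (z : ℤ) :
    orbit p q a b (d + 1) z = next p q a b (orbit p q a b d z) :=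
  Function.iterate_succ_apply' _ _ _

theorem isTarget_next (z : ℤ) : IsTarget q b (next p q a b z) := by
  simp [IsTarget, next]

theorem next_injOn (hp : 1 ≤ p) (hq : 1 ≤ q) {z z' : ℤ} (h : IsSource p a z) (h' : IsSource p a z')
    (hzz : next p q a b z = next p q a b z') : z = z' := by
  obtain ⟨k, hk⟩ := h
  obtain ⟨k', hk'⟩ := h'
  have hp0 : (p : ℤ) ≠ 0 := by omega
  have hq0 : (q : ℤ) ≠ 0 := by omega
  unfold next at hzz
  rw [hk, hk', Int.mul_ediv_cancel_left _ hp0, Int.mul_ediv_cancel_left _ hp0] at hzz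
  have : k = k' := mul_left_cancel₀ hq0 (by linarith)
  subst this
  linarith

theorem next_eq_of_linked (hp : 1 ≤ p) {u v : ℕ+} (h : Linked p q a b u v) :
    IsSource p a (u : ℕ) ∧ next p q a b (u : ℕ) = (v : ℕ) := by
  obtain ⟨k, -, hu, hv⟩ := h
  have hp0 : (p : ℤ) ≠ 0 := by omega
  refine ⟨⟨k, by rw [hu]; ring⟩, ?_⟩
  rw [next, hu, hv, add_sub_cancel_right, Int.mul_ediv_cancel_left _ hp0]

/-- Beyond the threshold, `next` is strictly increasing along a constraint `(pk + a, qk + b)`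
with `k ≥ 1`. -/
theorem exists_of_isSource (hp : 1 ≤ p) (hpq : p < q) {z : ℤ} (hz : threshold q a b ≤ z)
    (h : IsSource p a z) :
    ∃ k : ℕ, 1 ≤ k ∧ z = p * k + a ∧ next p q a b z = q * k + b ∧ z < next p q a b z := by
  obtain ⟨k, hk⟩ := h
  have hp0 : (p : ℤ) ≠ 0 := by omega
  have hp1 : (1 : ℤ) ≤ p := by omega
  have hq1 : (p : ℤ) + 1 ≤ q := by omega
  have hn : next p q a b z = q * k + b := by
    rw [next, hk, Int.mul_ediv_cancel_left _ hp0]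
  unfold threshold at hz
  have ha := abs_nonneg a
  have hb := abs_nonneg b
  have ha1 := le_abs_self a
  have ha2 := neg_abs_le a
  have hb1 := le_abs_self b
  have hb2 := neg_abs_le b
  have hk1 : 2 + |a| + |b| - |a| ≤ k := by
    by_contra hlt
    push Not at hlt
    have h2 : k + 1 ≤ 2 + |b| := by linarith
    nlinarith
  have hkk : 1 ≤ k := by linarith
  refine ⟨k.toNat, by omega, ?_, ?_, ?_⟩
  · rw [Int.toNat_of_nonneg (by omega)]; linarith
  · rw [Int.toNat_of_nonneg (by omega)]; exact hn
  · rw [hn]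
    have hz2 : z = p * k + a := by linarith
    have h3 : (q : ℤ) * (z - a) = p * (q * k) := by rw [hz2]; ring
    -- The difference of the two sides is `(q - p) z - q a + p b`, at least `z - q|a| - q|b|`, hence
    -- positive by the choice of the threshold.
    have h4 : (p : ℤ) * z < p * (q * k + b) := by
      have e1 : (q : ℤ) * a ≤ q * |a| := by nlinarith
      have e2 : -((p : ℤ) * b) ≤ q * |b| := by nlinarith
      have hz0 : 0 ≤ z := le_trans (by positivity) hz
      have e3 : 0 ≤ ((q : ℤ) - p - 1) * z := mul_nonneg (by linarith) hz0
      nlinarith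
    exact lt_of_mul_lt_mul_left h4 (by omega)

theorem exists_linked_of_isTarget (hp : 1 ≤ p) (hpq : p < q) {v : ℕ+}
    (hv : threshold q a b ≤ (v : ℕ)) (h : IsTarget q b (v : ℕ)) : ∃ u : ℕ+, Linked p q a b u v := by
  obtain ⟨k, hk⟩ := h
  have hp1 : (1 : ℤ) ≤ p := by omega
  have hq1 : (1 : ℤ) ≤ q := by omega
  unfold threshold at hv
  have ha := abs_nonneg a
  have ha2 := neg_abs_le a
  have hb1 := le_abs_self b
  have hb := abs_nonneg b
  have hkk : 1 + |a| ≤ k := by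
    by_contra hlt
    push Not at hlt
    nlinarith
  have hpos : 0 < (p : ℤ) * k + a := by nlinarith
  refine ⟨⟨((p : ℤ) * k + a).toNat, by omega⟩, k.toNat, by omega, ?_, ?_⟩
  · rw [Int.toNat_of_nonneg (by omega : 0 ≤ k)]
    simp only [PNat.mk_coe]
    rw [Int.toNat_of_nonneg hpos.le]
  · rw [Int.toNat_of_nonneg (by omega : 0 ≤ k)]; linarith

theorem linked_of_isSource (hp : 1 ≤ p) (hpq : p < q) {u v : ℕ+}
    (hu : threshold q a b ≤ (u : ℕ)) (h : IsSource p a (u : ℕ))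
    (hv : next p q a b (u : ℕ) = (v : ℕ)) : Linked p q a b u v := by
  obtain ⟨k, h1, h2, h3, -⟩ := exists_of_isSource (b := b) hp hpq hu h
  exact ⟨k, h1, h2, hv ▸ h3⟩

theorem threshold_pos (hq : 1 ≤ q) : 0 < threshold q a b := by
  unfold threshold
  have ha := abs_nonneg a
  have hb := abs_nonneg b
  have : (1 : ℤ) ≤ q := by omega
  positivity

theorem add_le_orbit (hp : 1 ≤ p) (hpq : p < q) {z : ℤ} (hz : threshold q a b ≤ z) {d : ℕ}
    (h : ∀ e < d, IsSource p a (orbit p q a b e z)) (c : ℕ) (hc : c ≤ d) :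
    z + c ≤ orbit p q a b c z := by
  induction c with
  | zero => simp [orbit_zero]
  | succ c ih =>
    have h1 := ih (by omega)
    obtain ⟨-, -, -, -, h2⟩ := exists_of_isSource (b := b) hp hpq (by omega) (h c (by omega))
    rw [orbit_succ]
    push_cast
    omega

theorem le_orbit (hp : 1 ≤ p) (hpq : p < q) {z : ℤ} (hz : threshold q a b ≤ z) {d : ℕ}
    (h : ∀ e < d, IsSource p a (orbit p q a b e z)) : z ≤ orbit p q a b d z := by
  have := add_le_orbit hp hpq hz h d le_rfl
  omega

theorem orbit_lt_orbit (hp : 1 ≤ p) (hpq : p < q) {z : ℤ} (hz : threshold q a b ≤ z) {d e : ℕ}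
    (h : ∀ e < d, IsSource p a (orbit p q a b e z)) (hed : e < d) :
    orbit p q a b e z < orbit p q a b d z := by
  induction d with
  | zero => omega
  | succ d ih =>
    obtain ⟨-, -, -, -, h2⟩ := exists_of_isSource (b := b) hp hpq
      (hz.trans (le_orbit hp hpq hz fun e he => h e (by omega))) (h d (by omega))
    rw [← orbit_succ] at h2
    rcases Nat.lt_succ_iff_lt_or_eq.1 hed with h3 | rfl
    · exact (ih (fun e he => h e (by omega)) h3).trans h2
    · exact h2

/-- Walk back from `v`: `next` is injective on sources, so predecessors agree, and both walks must
stop together since a start is not a target while every later member is one. -/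
theorem IsMember.unique (hp : 1 ≤ p) (hpq : p < q) {u u' v : ℤ} {d d' : ℕ}
    (hu : IsStart q a b u) (hu' : IsStart q a b u') (h : IsMember p q a b u d v)
    (h' : IsMember p q a b u' d' v) : u = u' ∧ d = d' := by
  induction d generalizing d' v with
  | zero =>
    obtain ⟨-, h⟩ := h
    rw [orbit_zero] at h
    subst h
    cases d' with
    | zero => exact ⟨h'.2.symm, rfl⟩
    | succ d' =>
      refine absurd ?_ hu.2
      rw [← h'.2, orbit_succ]
      exact isTarget_next _
  | succ d ih =>
    cases d' with
    | zero =>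
      refine absurd ?_ hu'.2
      have h2 := h'.2
      rw [orbit_zero] at h2
      rw [h2, ← h.2, orbit_succ]
      exact isTarget_next _
    | succ d' =>
      have heq : orbit p q a b d u = orbit p q a b d' u' := by
        apply next_injOn (q := q) (b := b) hp (by omega) (h.1 d (by omega)) (h'.1 d' (by omega))
        rw [← orbit_succ, ← orbit_succ, h.2, h'.2]
      obtain ⟨h1, h2⟩ := ih (v := orbit p q a b d u) ⟨fun e he => h.1 e (by omega), rfl⟩
        ⟨fun e he => h'.1 e (by omega), heq.symm⟩
      exact ⟨h1, by omega⟩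

/-- The fixed point of the affine map `pk + a ↦ qk + b`. -/
noncomputable def fixedPoint (p q : ℕ) (a b : ℤ) : ℝ := (q * a - p * b) / (q - p)

/-- Centred at its fixed point the affine map is linear of slope `q/p`. Iterating is then exact, and
a bound on the `d`-th member is a bound on the start. -/
theorem next_sub_fixedPoint (hp : 1 ≤ p) (hpq : p < q) {z : ℤ} (h : IsSource p a z) :
    ((p : ℝ) / q) * ((next p q a b z : ℝ) - fixedPoint p q a b) = z - fixedPoint p q a b := by
  obtain ⟨k, hk⟩ := h
  have hp0 : (p : ℤ) ≠ 0 := by omega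
  have hn : next p q a b z = q * k + b := by
    rw [next, hk, Int.mul_ediv_cancel_left _ hp0]
  have hz : (z : ℝ) = p * k + a := by
    have : z = p * k + a := by linarith
    rw [this]; push_cast; ring
  have hq : (q : ℝ) ≠ 0 := by
    have : 0 < q := by omega
    positivity
  have hpq' : (q : ℝ) - p ≠ 0 := by
    have : (p : ℝ) < q := by exact_mod_cast hpq
    linarith
  rw [hn, hz, fixedPoint]
  push_cast
  field_simp
  ring

theorem orbit_sub_fixedPoint (hp : 1 ≤ p) (hpq : p < q) {z : ℤ} {d : ℕ}
    (h : ∀ e < d, IsSource p a (orbit p q a b e z)) :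
    ((p : ℝ) / q) ^ d * ((orbit p q a b d z : ℝ) - fixedPoint p q a b) = z - fixedPoint p q a b := by
  induction d with
  | zero => simp [orbit_zero]
  | succ d ih =>
    rw [orbit_succ, pow_succ, mul_assoc, next_sub_fixedPoint hp hpq (h d (by omega)),
      ih fun e he => h e (by omega)]

/-- The number of integers `u ≥ 0` with `u < cutoff p q a b d n` is the number of those for which
the `d`-th member of the chain of `u` is at most `n`. -/
noncomputable def cutoff (p q : ℕ) (a b : ℤ) (d n : ℕ) : ℕ :=
  (⌊((p : ℝ) / q) ^ d * (n - fixedPoint p q a b) + fixedPoint p q a b⌋ + 1).toNat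

theorem orbit_le_iff_lt_cutoff (hp : 1 ≤ p) (hpq : p < q) {u d : ℕ}
    (h : ∀ e < d, IsSource p a (orbit p q a b e u)) (n : ℕ) :
    orbit p q a b d u ≤ n ↔ u < cutoff p q a b d n := by
  have hp0 : (0 : ℝ) < p := by exact_mod_cast hp
  have hq0 : (0 : ℝ) < q := by exact_mod_cast (by omega : 0 < q)
  have h1 := orbit_sub_fixedPoint (b := b) hp hpq h
  have hr : (0 : ℝ) < ((p : ℝ) / q) ^ d := by positivity
  rw [cutoff, Int.lt_toNat, Int.lt_add_one_iff, Int.le_floor, ← sub_le_iff_le_add, ← h1,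
    mul_le_mul_iff_right₀ hr, sub_le_sub_iff_right]
  exact_mod_cast Iff.rfl

theorem tendsto_cutoff_div (p q : ℕ) (a b : ℤ) (d : ℕ) :
    Tendsto (fun n : ℕ => (cutoff p q a b d n : ℝ) / n) atTop (𝓝 (((p : ℝ) / q) ^ d)) := by
  set c := fixedPoint p q a b with hc
  set r := ((p : ℝ) / q) ^ d with hr
  have hr0 : 0 ≤ r := by positivity
  refine tendsto_div_natCast_of_abs_sub_le (C := |c - r * c| + 1) fun n => ?_
  set z : ℤ := ⌊r * (n - c) + c⌋ + 1 with hz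
  have h1 : (cutoff p q a b d n : ℝ) = max (z : ℝ) 0 := by
    have : ((cutoff p q a b d n : ℕ) : ℤ) = max z 0 := by
      rw [cutoff]; exact Int.toNat_eq_max _
    exact_mod_cast this
  have h2 : (z : ℝ) ≤ r * (n - c) + c + 1 := by
    rw [hz]; push_cast
    have := Int.floor_le (r * (n - c) + c)
    linarith
  have h3 : r * (n - c) + c < z := by
    rw [hz]; push_cast
    exact Int.lt_floor_add_one _
  have h4 : 0 ≤ r * n := by positivity
  have h5 := neg_abs_le (c - r * c)
  have h6 := le_abs_self (c - r * c)
  have h7 := abs_nonneg (c - r * c)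
  rw [h1, abs_le]
  rcases max_cases (z : ℝ) 0 with ⟨h, -⟩ | ⟨h, h'⟩ <;> rw [h] <;> constructor <;> nlinarith

theorem tendsto_cutoff (hp : 1 ≤ p) (hpq : p < q) (a b : ℤ) (d : ℕ) :
    Tendsto (cutoff p q a b d) atTop atTop := by
  have hp0 : (0 : ℝ) < p := by exact_mod_cast hp
  have hq0 : (0 : ℝ) < q := by exact_mod_cast (by omega : 0 < q)
  have hr : (0 : ℝ) < ((p : ℝ) / q) ^ d := by positivity
  have h1 := (tendsto_cutoff_div p q a b d).pos_mul_atTop hr tendsto_natCast_atTop_atTop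
  rw [← tendsto_natCast_atTop_iff (R := ℝ)]
  refine h1.congr' ?_
  filter_upwards [eventually_gt_atTop 0] with n hn
  have : (n : ℝ) ≠ 0 := by positivity
  field_simp

end AffineShift

/-! ### The random sequence and the dimension bound from chain densities. -/

namespace AffineShift

variable {m p q : ℕ} {a b : ℤ} {A : Matrix (Fin m) (Fin m) ℝ}

open Classical in
/-- The sequence that carries the (extended) word `ω u` on the chain of each start `u`, and
agrees with `x₀` off these chains. -/
noncomputable def fill (p q : ℕ) (a b : ℤ) (σ : Fin m → Fin m) (z : Fin m) {n : ℕ}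
    (x₀ : SymbolSeq m) (ω : ℕ → Fin n → Fin m) : SymbolSeq m := fun v =>
  if h : ∃ ud : ℕ × ℕ, IsStart q a b ud.1 ∧ IsMember p q a b ud.1 ud.2 (v : ℕ) then
    extend σ z (ω h.choose.1) h.choose.2
  else x₀ v

theorem fill_of_isMember (hp : 1 ≤ p) (hpq : p < q) (σ : Fin m → Fin m) (z : Fin m) {n : ℕ}
    (x₀ : SymbolSeq m) (ω : ℕ → Fin n → Fin m) {u d : ℕ} {v : ℕ+} (hu : IsStart q a b u)
    (h : IsMember p q a b u d (v : ℕ)) :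
    fill p q a b σ z x₀ ω v = extend σ z (ω u) d := by
  have hex : ∃ ud : ℕ × ℕ, IsStart q a b ud.1 ∧ IsMember p q a b ud.1 ud.2 (v : ℕ) :=
    ⟨(u, d), hu, h⟩
  obtain ⟨h1, h2⟩ := IsMember.unique hp hpq hex.choose_spec.1 hu hex.choose_spec.2 h
  rw [fill, dif_pos hex, h2, Nat.cast_injective h1]

/-- The two ends of a constraint are consecutive members of one filled chain, where the word is
admissible, or both lie off the filled chains, where `x₀` already satisfies the constraint. -/
theorem fill_mem_shift (hp : 1 ≤ p) (hpq : p < q) {σ : Fin m → Fin m} {z : Fin m} {n : ℕ}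
    {x₀ : SymbolSeq m} (hx₀ : x₀ ∈ shift A p q a b) {ω : ℕ → Fin n → Fin m}
    (hω : ∀ u d, A (extend σ z (ω u) d) (extend σ z (ω u) (d + 1)) = 1) :
    fill p q a b σ z x₀ ω ∈ shift A p q a b := by
  intro v v' hvv
  obtain ⟨hs, hn⟩ := next_eq_of_linked hp hvv
  by_cases h : ∃ ud : ℕ × ℕ, IsStart q a b ud.1 ∧ IsMember p q a b ud.1 ud.2 (v : ℕ)
  · obtain ⟨⟨u, d⟩, hu, hd⟩ := h
    have hd' : IsMember p q a b u (d + 1) (v' : ℕ) := by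
      refine ⟨fun e he => ?_, by rw [orbit_succ, hd.2, hn]⟩
      rcases Nat.lt_succ_iff_lt_or_eq.1 he with h1 | rfl
      · exact hd.1 e h1
      · rw [hd.2]; exact hs
    rw [fill_of_isMember hp hpq σ z x₀ ω hu hd, fill_of_isMember hp hpq σ z x₀ ω hu hd']
    exact hω u d
  · have h' : ¬ ∃ ud : ℕ × ℕ, IsStart q a b ud.1 ∧ IsMember p q a b ud.1 ud.2 (v' : ℕ) := by
      rintro ⟨⟨u, d⟩, hu, hd⟩
      cases d with
      | zero =>
        apply hu.2
        have := hd.2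
        rw [orbit_zero] at this
        rw [this, ← hn]
        exact isTarget_next _
      | succ d =>
        refine h ⟨⟨u, d⟩, hu, fun e he => hd.1 e (Nat.lt_succ_of_lt he), ?_⟩
        apply next_injOn (q := q) (b := b) hp (by omega) (hd.1 d (by simp)) hs
        rw [← orbit_succ, hd.2, hn]
    have e1 : fill p q a b σ z x₀ ω v = x₀ v := by rw [fill, dif_neg h]
    have e2 : fill p q a b σ z x₀ ω v' = x₀ v' := by rw [fill, dif_neg h']
    rw [e1, e2]
    exact hx₀ v v' hvv

open Classical in
/-- The starts up to `n`. -/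
noncomputable def starts (q : ℕ) (a b : ℤ) (n : ℕ) : Finset ℕ :=
  (Finset.range (n + 1)).filter fun u => IsStart q a b u

open Classical in
-- On the chain of `u`, the positions up to `n` among the first `cls u` form a prefix, so agreeing
-- up to `n` fixes a prefix of each word `ω u`. Independence gives the product of the prefix masses.
theorem measure_cylinder_fill_le (hp : 1 ≤ p) (hpq : p < q) {ρ : ℝ} {σ : Fin m → Fin m} {z : Fin m}
    {I : ℕ} {x₀ : SymbolSeq m} {cls : ℕ → ℕ} (hI : ∀ u, cls u ≤ I)
    (hcls : ∀ u d : ℕ, IsStart q a b u → d + 1 < cls u → IsSource p a (orbit p q a b d u))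
    (hL0 : ∀ i d x, 0 ≤ letterWeight A ρ σ z i d x)
    (ν : ℕ → Measure (Fin I → Fin m)) [∀ u, IsProbabilityMeasure (ν u)]
    (hν : ∀ u, ∀ j ≤ I, ∀ w, ν u {w' | ∀ e : Fin I, (e : ℕ) < j → w' e = w e}
        = ENNReal.ofReal (∏ d ∈ Finset.range j, letterWeight A ρ σ z (cls u) d (extend σ z w)))
    (ω : ℕ → Fin I → Fin m) (n : ℕ) :
    Measure.infinitePi ν {ω' | ∀ v : ℕ+, (v : ℕ) ≤ n →
        fill p q a b σ z x₀ ω' v = fill p q a b σ z x₀ ω v}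
      ≤ ENNReal.ofReal (∏ u ∈ starts q a b n,
          ∏ d ∈ (Finset.range (cls u)).filter (fun d => orbit p q a b d u ≤ n),
            letterWeight A ρ σ z (cls u) d (extend σ z (ω u))) := by
  have hJ : ∀ u : ℕ, ∃ j ≤ cls u, IsStart q a b u →
      (Finset.range (cls u)).filter (fun d => orbit p q a b d u ≤ n) = Finset.range j := by
    intro u
    by_cases hu : IsStart q a b u
    · obtain ⟨j, hj, h⟩ := exists_filter_range_eq_range (fun d => orbit p q a b d u ≤ n) (cls u)
        (fun d e hde hec he => by
          rcases hde.eq_or_lt with rfl | hlt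
          · exact he
          · exact (orbit_lt_orbit hp hpq hu.1
              (fun e' he' => hcls u e' hu (by omega)) hlt).le.trans he)
      exact ⟨j, hj, fun _ => h⟩
    · exact ⟨0, by omega, fun h => absurd h hu⟩
  choose J hJ1 hJ2 using hJ
  calc Measure.infinitePi ν {ω' | ∀ v : ℕ+, (v : ℕ) ≤ n →
        fill p q a b σ z x₀ ω' v = fill p q a b σ z x₀ ω v}
      ≤ Measure.infinitePi ν (Set.pi (starts q a b n)
          (fun u => {w' | ∀ e : Fin I, (e : ℕ) < J u → w' e = ω u e})) := by
        refine measure_mono fun ω' hω' u hu e he => ?_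
        have hu' : IsStart q a b u := (Finset.mem_filter.1 hu).2
        have heJ : (e : ℕ) ∈ (Finset.range (cls u)).filter (fun d => orbit p q a b d u ≤ n) := by
          rw [hJ2 u hu']; exact Finset.mem_range.2 he
        obtain ⟨he1, he2⟩ := Finset.mem_filter.1 heJ
        have hsrc : ∀ e' < (e : ℕ), IsSource p a (orbit p q a b e' u) := fun e' he' =>
          hcls u e' hu' (by have := Finset.mem_range.1 he1; omega)
        have hpos : 0 < orbit p q a b e u :=
          (threshold_pos (by omega)).trans_le (hu'.1.trans (le_orbit hp hpq hu'.1 hsrc))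
        let v : ℕ+ := ⟨(orbit p q a b e u).toNat, by omega⟩
        have hv : ((v : ℕ) : ℤ) = orbit p q a b e u := Int.toNat_of_nonneg hpos.le
        have hmem : IsMember p q a b u e (v : ℕ) := ⟨hsrc, hv.symm⟩
        have := hω' v (by omega)
        rw [fill_of_isMember hp hpq σ z x₀ _ hu' hmem, fill_of_isMember hp hpq σ z x₀ _ hu' hmem,
          extend_of_lt σ z _ e.2, extend_of_lt σ z _ e.2] at this
        exact this
    _ = ∏ u ∈ starts q a b n, ν u {w' | ∀ e : Fin I, (e : ℕ) < J u → w' e = ω u e} :=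
        Measure.infinitePi_pi _ fun u _ => MeasurableSet.of_discrete
    _ = ∏ u ∈ starts q a b n, ENNReal.ofReal
          (∏ d ∈ (Finset.range (cls u)).filter (fun d => orbit p q a b d u ≤ n),
            letterWeight A ρ σ z (cls u) d (extend σ z (ω u))) := by
        refine Finset.prod_congr rfl fun u hu => ?_
        rw [hν u _ ((hJ1 u).trans (hI u)), hJ2 u (Finset.mem_filter.1 hu).2]
    _ = _ := by
        rw [ENNReal.ofReal_prod_of_nonneg]
        exact fun u _ => Finset.prod_nonneg fun d _ => hL0 _ _ _

open Classical in
-- Sorting by class and depth turns the condition on a member into `u < cutoff p q a b d n`, so that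
-- the strong law applies to each inner sum. Starts of class `0` contribute nothing.
theorem sum_starts_eq (hp : 1 ≤ p) (hpq : p < q) {I : ℕ} {cls : ℕ → ℕ} (hI : ∀ u, cls u ≤ I)
    (hcls : ∀ u d : ℕ, IsStart q a b u → d + 1 < cls u → IsSource p a (orbit p q a b d u))
    (h : ℕ → ℕ → ℕ → ℝ) (n : ℕ) :
    ∑ u ∈ starts q a b n, ∑ d ∈ (Finset.range (cls u)).filter (fun d => orbit p q a b d u ≤ n),
        h (cls u) d u
      = ∑ i ∈ Finset.Icc 1 I, ∑ d ∈ Finset.range i, ∑ u ∈ Finset.range (cutoff p q a b d n),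
          {u : ℕ | IsStart q a b u ∧ cls u = i}.indicator (h i d) u := by
  have hset : ∀ i, ∀ d ∈ Finset.range i,
      (Finset.range (cutoff p q a b d n)).filter (fun u : ℕ => IsStart q a b u ∧ cls u = i)
        = (starts q a b n).filter (fun u => cls u = i ∧ orbit p q a b d u ≤ n) := by
    intro i d hd
    ext u
    simp only [Finset.mem_filter, Finset.mem_range, starts]
    have hd' := Finset.mem_range.1 hd
    constructor
    · rintro ⟨h1, h2, h3⟩
      have hs : ∀ e < d, IsSource p a (orbit p q a b e u) := fun e he =>
        hcls u e h2 (by omega)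
      have h4 := (orbit_le_iff_lt_cutoff hp hpq hs n).2 h1
      have h5 := le_orbit hp hpq h2.1 hs
      exact ⟨⟨by omega, h2⟩, h3, h4⟩
    · rintro ⟨⟨h1, h2⟩, h3, h4⟩
      have hs : ∀ e < d, IsSource p a (orbit p q a b e u) := fun e he =>
        hcls u e h2 (by omega)
      exact ⟨(orbit_le_iff_lt_cutoff hp hpq hs n).1 h4, h2, h3⟩
  have hind : ∀ i, ∀ d ∈ Finset.range i, ∑ u ∈ Finset.range (cutoff p q a b d n),
      {u : ℕ | IsStart q a b u ∧ cls u = i}.indicator (h i d) u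
      = ∑ u ∈ starts q a b n, if cls u = i ∧ orbit p q a b d u ≤ n then h i d u else 0 := by
    intro i d hd
    rw [← Finset.sum_filter, ← hset i d hd, Finset.sum_filter]
    refine Finset.sum_congr rfl fun u _ => ?_
    simp only [Set.indicator_apply, Set.mem_ofPred_eq]
  rw [Finset.sum_congr rfl fun i _ => Finset.sum_congr rfl (hind i)]
  have hcomm : ∀ i ∈ Finset.Icc 1 I, ∑ d ∈ Finset.range i, ∑ u ∈ starts q a b n,
      (if cls u = i ∧ orbit p q a b d u ≤ n then h i d u else 0)
      = ∑ u ∈ starts q a b n, ∑ d ∈ Finset.range i,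
        (if cls u = i ∧ orbit p q a b d u ≤ n then h i d u else 0) := fun i _ => Finset.sum_comm
  rw [Finset.sum_congr rfl hcomm, Finset.sum_comm (s := Finset.Icc 1 I)]
  refine Finset.sum_congr rfl fun u _ => ?_
  rw [Finset.sum_filter]
  by_cases h0 : cls u = 0
  · rw [h0]
    simp only [Finset.range_zero, Finset.sum_empty]
    refine (Finset.sum_eq_zero fun i hi => Finset.sum_eq_zero fun d _ => ?_).symm
    rw [if_neg]
    rintro ⟨rfl, -⟩
    have := (Finset.mem_Icc.1 hi).1
    omega
  · rw [Finset.sum_eq_single (s := Finset.Icc 1 I) (cls u)]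
    · simp
    · intro i _ hne
      refine Finset.sum_eq_zero fun d _ => if_neg fun hh => hne hh.1.symm
    · intro hh
      exact absurd (Finset.mem_Icc.2 ⟨by omega, hI u⟩) hh

/-- Lower bound for the dimension from finitely many classes of chains with known densities: the
first `cls u` letters on the chain of `u` are chosen by the optimal Markov measure. -/
theorem ofReal_sum_density_mul_logb_le_dimH (hm : 2 ≤ m) (hbin : ∀ i j, A i j = 0 ∨ A i j = 1)
    (hrow : ∀ i, ∃ j, A i j = 1) (hp : 1 ≤ p) (hpq : p < q)
    (hne : (shift A p q a b).Nonempty) {I : ℕ} {cls : ℕ → ℕ} (hI : ∀ u, cls u ≤ I)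
    (hcls : ∀ u d : ℕ, IsStart q a b u → d + 1 < cls u → IsSource p a (orbit p q a b d u))
    {β : ℕ → ℝ} (hβ : ∀ i ∈ Finset.Icc 1 I, HasDensity {u : ℕ | IsStart q a b u ∧ cls u = i} (β i)) :
    ENNReal.ofReal (∑ i ∈ Finset.Icc 1 I, β i * Real.logb m (partitionSum A ((p : ℝ) / q) i))
      ≤ dimH (shift A p q a b) := by
  classical
  obtain ⟨x₀, hx₀⟩ := hne
  choose σ hσ using hrow
  have hrow : ∀ i, ∃ j, A i j = 1 := fun i => ⟨σ i, hσ i⟩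
  let z : Fin m := ⟨0, by omega⟩
  set ρ : ℝ := (p : ℝ) / q with hρdef
  have hρ : 0 ≤ ρ := by positivity
  have hm0 : 0 < m := by omega
  have hm1 : (1 : ℝ) < m := by exact_mod_cast hm
  -- All words have the same length `I`, so that the product is over one type; in class `i` the
  -- letters from index `i` on are deterministic.
  choose ν₀ hν₀p hν₀ hν₀ae using fun i => exists_wordMeasure hbin hrow hρ hm0 hσ z I i
  let ν : ℕ → Measure (Fin I → Fin m) := fun u => ν₀ (cls u)
  let P := Measure.infinitePi ν
  let h : ℕ → ℕ → (Fin I → Fin m) → ℝ := fun i d w =>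
    -Real.log (letterWeight A ρ σ z i d (extend σ z w))
  have hae : ∀ᵐ ω ∂P, ∀ u, (∀ d < I, 0 < letterWeight A ρ σ z (cls u) d (extend σ z (ω u))) ∧
      ∀ d, A (extend σ z (ω u) d) (extend σ z (ω u) (d + 1)) = 1 := by
    rw [ae_all_iff]
    intro u
    exact (measurePreserving_eval_infinitePi ν u).quasiMeasurePreserving.ae (hν₀ae (cls u))
  have hslln : ∀ᵐ ω ∂P, ∀ i ∈ Finset.Icc 1 I, ∀ d : ℕ, Tendsto
      (fun n : ℕ => (∑ u ∈ Finset.range n,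
        {u : ℕ | IsStart q a b u ∧ cls u = i}.indicator (fun v => h i d (ω v)) u) / n) atTop
      (𝓝 (β i * ∫ w, h i d w ∂(ν₀ i))) := by
    rw [ae_all_iff]
    intro i
    by_cases hi : i ∈ Finset.Icc 1 I
    · simp only [hi, true_imp_iff]
      rw [ae_all_iff]
      intro d
      exact strong_law_along_density ν (ν₀ i) {u : ℕ | IsStart q a b u ∧ cls u = i}
        (fun u hu => by simp only [ν, hu.2]) (hβ i hi) (h i d)
    · simp [hi]
  have hent : ∀ i ∈ Finset.Icc 1 I, ∑ d ∈ Finset.range i, ρ ^ d * ∫ w, h i d w ∂(ν₀ i)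
      = Real.log (partitionSum A ρ i) := by
    intro i hi
    have hi1 := (Finset.mem_Icc.1 hi).1
    simp only [← integral_const_mul]
    rw [← integral_finsetSum _ fun d _ => Integrable.of_finite]
    rw [integral_congr_ae (g := fun _ => Real.log (partitionSum A ρ i))]
    · simp
    -- The discounted sum is almost surely constant, so its mean is that constant.
    · filter_upwards [hν₀ae i] with w hw
      exact sum_pow_mul_neg_log_letterWeight hbin hrow hρ hm0 σ z hi1 fun d _ => hw.2 d
  refine SymbolSeq.ofReal_le_dimH_of_cylinder_le hm P (fill p q a b σ z x₀) _ _ ?_ ?_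
  · filter_upwards [hae] with ω hω
    exact fill_mem_shift hp hpq hx₀ fun u d => (hω u).2 d
  · filter_upwards [hae, hslln] with ω hω hlaw D' hD'
    let S : ℕ → ℝ := fun n => ∑ i ∈ Finset.Icc 1 I, ∑ d ∈ Finset.range i,
      ∑ u ∈ Finset.range (cutoff p q a b d n),
        {u : ℕ | IsStart q a b u ∧ cls u = i}.indicator (fun v => h i d (ω v)) u
    have hS : Tendsto (fun n : ℕ => S n / n) atTop
        (𝓝 (∑ i ∈ Finset.Icc 1 I, β i * Real.log (partitionSum A ρ i))) := by
      have hlim : ∀ i ∈ Finset.Icc 1 I, β i * Real.log (partitionSum A ρ i)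
          = ∑ d ∈ Finset.range i, β i * (∫ w, h i d w ∂(ν₀ i)) * ρ ^ d := by
        intro i hi
        rw [← hent i hi, Finset.mul_sum]
        exact Finset.sum_congr rfl fun d _ => by ring
      rw [Finset.sum_congr rfl hlim]
      simp only [S, Finset.sum_div]
      refine tendsto_finsetSum _ fun i hi => tendsto_finsetSum _ fun d _ => ?_
      simp only [← Finset.sum_div]
      -- The strong law is read at time `cutoff p q a b d n`, about `ρ^d n`; this produces the
      -- discount factor.
      have h1 := (hlaw i hi d).comp (tendsto_cutoff hp hpq a b d)
      refine (h1.mul (tendsto_cutoff_div p q a b d)).congr' ?_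
      filter_upwards [(tendsto_cutoff hp hpq a b d).eventually_gt_atTop 0] with n hn
      have : ((cutoff p q a b d n : ℕ) : ℝ) ≠ 0 := by positivity
      simp only [Function.comp]
      field_simp
    have hD'' : D' * Real.log m
        < ∑ i ∈ Finset.Icc 1 I, β i * Real.log (partitionSum A ρ i) := by
      have hlog : 0 < Real.log m := Real.log_pos hm1
      rw [← lt_div_iff₀ hlog, Finset.sum_div]
      refine hD'.trans_eq (Finset.sum_congr rfl fun i _ => ?_)
      rw [Real.logb, mul_div_assoc]
    filter_upwards [hS.eventually_const_lt hD'', eventually_gt_atTop 0] with n hn hn0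
    have hn0' : (0 : ℝ) < n := Nat.cast_pos.2 hn0
    refine (measure_cylinder_fill_le hp hpq hI hcls
      (letterWeight_nonneg hbin hrow hρ σ z) ν (fun u => hν₀ (cls u)) ω n).trans ?_
    apply ENNReal.ofReal_le_ofReal
    have hpos : ∀ u : ℕ, ∀ d ∈ (Finset.range (cls u)).filter (fun d => orbit p q a b d u ≤ n),
        0 < letterWeight A ρ σ z (cls u) d (extend σ z (ω u)) := fun u d hd =>
      (hω u).1 d ((Finset.mem_range.1 (Finset.mem_filter.1 hd).1).trans_le (hI u))
    have hppos : ∀ u : ℕ, 0 < ∏ d ∈ (Finset.range (cls u)).filter (fun d => orbit p q a b d u ≤ n),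
        letterWeight A ρ σ z (cls u) d (extend σ z (ω u)) := fun u => Finset.prod_pos (hpos u)
    rw [← Real.log_le_log_iff (Finset.prod_pos fun u _ => hppos u)
      (Real.rpow_pos_of_pos (by positivity) _), Real.log_rpow (by positivity),
      Real.log_prod fun u _ => (hppos u).ne']
    rw [Finset.sum_congr rfl fun u _ => Real.log_prod fun d hd => (hpos u d hd).ne']
    have hsum := sum_starts_eq hp hpq hI hcls (fun i d u => h i d (ω u)) n
    simp only [h, Finset.sum_neg_distrib] at hsum
    have hSn : ∑ u ∈ starts q a b n,
        ∑ d ∈ (Finset.range (cls u)).filter (fun d => orbit p q a b d u ≤ n),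
          Real.log (letterWeight A ρ σ z (cls u) d (extend σ z (ω u))) = -S n := by
      rw [← neg_eq_iff_eq_neg, hsum]
    rw [hSn]
    rw [lt_div_iff₀ hn0'] at hn
    linarith

end AffineShift

/-! ### Elementary densities. -/

theorem hasDensity_univ : HasDensity Set.univ 1 := by
  refine tendsto_div_natCast_of_abs_sub_le (C := 0) fun n => ?_
  simp

theorem hasDensity_empty : HasDensity ∅ 0 := by
  refine tendsto_div_natCast_of_abs_sub_le (C := 0) fun n => ?_
  simp

theorem HasDensity.diff {B C : Set ℕ} {β γ : ℝ} (hB : HasDensity B β) (hC : HasDensity C γ)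
    (h : C ⊆ B) : HasDensity (B \ C) (β - γ) := by
  refine (Tendsto.sub hB hC).congr fun n => ?_
  rw [← sub_div, ← Finset.sum_sub_distrib]
  congr 1
  refine Finset.sum_congr rfl fun u _ => ?_
  by_cases h1 : u ∈ C
  · simp [h1, h h1]
  · by_cases h2 : u ∈ B <;> simp [h1, h2]

theorem HasDensity.congr {B C : Set ℕ} {β : ℝ} (hB : HasDensity B β)
    (h : ∀ᶠ u in atTop, u ∈ B ↔ u ∈ C) : HasDensity C β := by
  obtain ⟨N, hN⟩ := eventually_atTop.1 h
  set f : ℕ → ℝ := fun u => C.indicator (fun _ => (1 : ℝ)) u - B.indicator (fun _ => (1 : ℝ)) u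
  have h1 : Tendsto (fun n : ℕ => (∑ u ∈ Finset.range N, f u) / n) atTop (𝓝 0) :=
    tendsto_const_div_atTop_nhds_zero_nat _
  have h2 := Tendsto.add hB h1
  rw [add_zero] at h2
  refine h2.congr' ?_
  filter_upwards [eventually_ge_atTop N] with n hn
  have h3 : ∑ u ∈ Finset.range N, f u = ∑ u ∈ Finset.range n, f u := by
    refine Finset.sum_subset (by simpa using hn) fun u _ hu => ?_
    have hu' : N ≤ u := by simpa using hu
    by_cases h4 : u ∈ B
    · simp [f, h4, (hN u hu').1 h4]
    · have h5 : u ∉ C := fun h5 => h4 ((hN u hu').2 h5)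
      simp [f, h4, h5]
  rw [← add_div, h3, ← Finset.sum_add_distrib]
  simp [f]

theorem hasDensity_dvd_sub {N : ℕ} (hN : 0 < N) (v : ℤ) :
    HasDensity {u : ℕ | (N : ℤ) ∣ u - v} (1 / N) := by
  have hN0 : (0 : ℝ) < N := Nat.cast_pos.2 hN
  refine tendsto_div_natCast_of_abs_sub_le (C := 1) fun n => ?_
  have hNz : (N : ℤ) ≠ 0 := by omega
  set r : ℕ := (v % N).toNat with hr
  have hrv : (r : ℤ) = v % N := Int.toNat_of_nonneg (Int.emod_nonneg _ hNz)
  have hset : {u : ℕ | (N : ℤ) ∣ u - v} = {u : ℕ | u ≡ r [MOD N]} := by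
    ext u
    simp only [Set.mem_ofPred_eq]
    rw [← Int.natCast_modEq_iff, hrv, ← Int.modEq_iff_dvd]
    exact ⟨fun h => h.symm.trans (Int.mod_modEq v N).symm,
      fun h => (h.trans (Int.mod_modEq v N)).symm⟩
  have hcount : ∀ _ : DecidablePred (· ∈ {u : ℕ | u ≡ r [MOD N]}),
      Nat.count (· ∈ {u : ℕ | u ≡ r [MOD N]}) n = Nat.count (· ≡ r [MOD N]) n := fun _ => by
    rw [Nat.count_eq_card_filter_range, Nat.count_eq_card_filter_range]
    congr 1
    ext
    simp
  rw [hset, sum_indicator_one_range, hcount, Nat.count_modEq_card n hN r]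
  have h1 := Nat.div_add_mod n N
  have h2 := Nat.mod_lt n hN
  have h3 : (n : ℝ) = N * (n / N : ℕ) + (n % N : ℕ) := by exact_mod_cast h1.symm
  have h4 : ((n % N : ℕ) : ℝ) / N < 1 := by
    rw [div_lt_one hN0]; exact_mod_cast h2
  have h5 : 0 ≤ ((n % N : ℕ) : ℝ) / N := by positivity
  have h6 : 1 / (N : ℝ) * n = (n / N : ℕ) + ((n % N : ℕ) : ℝ) / N := by
    rw [h3]
    field_simp
  rw [h6, abs_le]
  push_cast
  split_ifs <;> constructor <;> linarith

/-! ### The case where the gcd does not divide `b - a`. -/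

namespace AffineShift

variable {m p q : ℕ} {a b : ℤ} {A : Matrix (Fin m) (Fin m) ℝ}

/-- Up to finitely many elements, the starts are the non-targets. -/
theorem HasDensity.starts {Q : ℕ → Prop} {β : ℝ}
    (h : HasDensity {u : ℕ | ¬ IsTarget q b u ∧ Q u} β) :
    HasDensity {u : ℕ | IsStart q a b u ∧ Q u} β := by
  refine h.congr ?_
  filter_upwards [eventually_ge_atTop (threshold q a b).toNat] with u hu
  have : threshold q a b ≤ u := by omega
  simp [IsStart, this]

theorem exists_apply_eq_one (hm : 2 ≤ m) (hbin : ∀ i j, A i j = 0 ∨ A i j = 1)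
    (hirr : A.IsIrreducible) (i : Fin m) : ∃ j, A i j = 1 := by
  have : Nontrivial (Fin m) := Fin.nontrivial_iff_two_le.2 hm
  obtain ⟨j, hj⟩ := hirr.exists_pos i
  exact ⟨j, (hbin i j).resolve_left hj.ne'⟩

theorem partitionSum_one (ρ : ℝ) : partitionSum A ρ 1 = m := by
  simp [partitionSum, transfer]

theorem not_isTarget_of_isSource (h : ¬ ((p.gcd q : ℕ) : ℤ) ∣ b - a) {z : ℤ} (hz : IsSource p a z) :
    ¬ IsTarget q b z := by
  intro ht
  apply h
  have h1 : ((p.gcd q : ℕ) : ℤ) ∣ z - a := (Int.natCast_dvd_natCast.2 (Nat.gcd_dvd_left p q)).trans hz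
  have h2 : ((p.gcd q : ℕ) : ℤ) ∣ z - b := (Int.natCast_dvd_natCast.2 (Nat.gcd_dvd_right p q)).trans ht
  have := dvd_sub h1 h2
  rwa [sub_sub_sub_cancel_left] at this

/-- Sources and targets are disjoint, so one admissible pair of symbols, the second on targets and
the first elsewhere, satisfies every constraint. -/
theorem shift_nonempty_of_not_dvd (hm : 2 ≤ m) (hrow : ∀ i, ∃ j, A i j = 1) (hp : 1 ≤ p)
    (h : ¬ ((p.gcd q : ℕ) : ℤ) ∣ b - a) : (shift A p q a b).Nonempty := by
  classical
  let z : Fin m := ⟨0, by omega⟩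
  obtain ⟨j, hj⟩ := hrow z
  refine ⟨fun v => if IsTarget q b (v : ℕ) then j else z, fun u v huv => ?_⟩
  obtain ⟨h1, h2⟩ := next_eq_of_linked hp huv
  have h3 : IsTarget q b (v : ℕ) := h2 ▸ isTarget_next _
  change A (if IsTarget q b (u : ℕ) then j else z) (if IsTarget q b (v : ℕ) then j else z) = 1
  rw [if_neg (not_isTarget_of_isSource h h1), if_pos h3]
  exact hj

/-- A start has a chain of two members if it is a source (density `1/p`) and of one otherwise
(density `1 - 1/p - 1/q`). The corresponding partition sums are `∑ a_i^(p/q)` and `m`. -/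
theorem ofReal_le_dimH_of_not_dvd (hm : 2 ≤ m) (hbin : ∀ i j, A i j = 0 ∨ A i j = 1)
    (hrow : ∀ i, ∃ j, A i j = 1) (hp : 1 ≤ p) (hpq : p < q)
    (h : ¬ ((p.gcd q : ℕ) : ℤ) ∣ b - a) :
    ENNReal.ofReal (1 - 1 / (p : ℝ) - 1 / q
        + 1 / p * Real.logb m (∑ i, (∑ j, A i j) ^ ((p : ℝ) / q)))
      ≤ dimH (shift A p q a b) := by
  classical
  let cls : ℕ → ℕ := fun u => if IsSource p a u then 2 else 1
  let β : ℕ → ℝ := fun i => if i = 1 then 1 - 1 / (p : ℝ) - 1 / q else 1 / p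
  have hden := ofReal_sum_density_mul_logb_le_dimH (a := a) (b := b) (I := 2) (cls := cls) (β := β)
    hm hbin hrow hp hpq
    (shift_nonempty_of_not_dvd hm hrow hp h)
    (fun u => by simp only [cls]; split_ifs <;> omega)
    (fun u d _ hd => by
      simp only [cls] at hd
      split_ifs at hd with hs
      · obtain rfl : d = 0 := by omega
        exact hs
      · omega)
    (fun i hi => by
      have hi' := Finset.mem_Icc.1 hi
      refine HasDensity.starts ?_
      by_cases h1 : i = 1
      · subst h1
        have h2 := (hasDensity_univ.diff (hasDensity_dvd_sub (by omega : 0 < p) a)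
          (Set.subset_univ _)).diff (hasDensity_dvd_sub (by omega : 0 < q) b)
          (fun u hu => ⟨trivial, fun hs => not_isTarget_of_isSource h hs hu⟩)
        simp only [β, if_true]
        convert! h2 using 1
        ext u
        simp only [cls, Set.mem_ofPred_eq, Set.mem_sdiff, Set.mem_univ, true_and, IsTarget, IsSource]
        by_cases hs : (p : ℤ) ∣ u - a <;> simp [hs]
      · obtain rfl : i = 2 := by omega
        simp only [β, if_neg h1]
        convert! hasDensity_dvd_sub (by omega : 0 < p) a using 1
        ext u
        simp only [cls, Set.mem_ofPred_eq]
        constructor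
        · rintro ⟨-, h2⟩
          by_contra hs
          rw [if_neg (by exact hs)] at h2
          omega
        · intro hs
          exact ⟨not_isTarget_of_isSource h hs, if_pos hs⟩)
  refine le_of_eq_of_le (congrArg _ ?_) hden
  rw [show Finset.Icc 1 2 = {1, 2} from rfl, Finset.sum_pair (by norm_num), partitionSum_one]
  have hlog : Real.logb m m = 1 := Real.logb_self_eq_one (by exact_mod_cast hm)
  rw [hlog]
  simp [β, partitionSum, transfer]

/-! ### The case `p = 1`. -/

/-- The map `y ↦ (1/q) log (A exp y)`, a contraction for the supremum norm. -/
noncomputable def logTransfer (A : Matrix (Fin m) (Fin m) ℝ) (q : ℕ) (y : Fin m → ℝ) : Fin m → ℝ :=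
  fun s => Real.log (∑ b, A s b * Real.exp (y b)) / q

theorem sum_mul_exp_pos (hbin : ∀ i j, A i j = 0 ∨ A i j = 1) (hrow : ∀ i, ∃ j, A i j = 1)
    (y : Fin m → ℝ) (s : Fin m) : 0 < ∑ b, A s b * Real.exp (y b) := by
  obtain ⟨j, hj⟩ := hrow s
  refine Finset.sum_pos' (fun b _ => ?_) ⟨j, Finset.mem_univ j, ?_⟩
  · rcases hbin s b with h | h <;> simp [h, Real.exp_nonneg]
  · rw [hj, one_mul]; exact Real.exp_pos _

/-- Moving `y` by at most `r` in each coordinate multiplies `A exp y` by a factor at most `exp r`,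
so the logarithm moves by at most `r`; the division by `q` contracts. -/
theorem contractingWith_logTransfer (hbin : ∀ i j, A i j = 0 ∨ A i j = 1)
    (hrow : ∀ i, ∃ j, A i j = 1) (hq : 1 < q) :
    ContractingWith (1 / (q : ℝ≥0)) (logTransfer A q) := by
  have hq0 : (0 : ℝ) < q := by exact_mod_cast (by omega : 0 < q)
  have key : ∀ (y y' : Fin m → ℝ) (s : Fin m), Real.log (∑ b, A s b * Real.exp (y b))
      ≤ dist y y' + Real.log (∑ b, A s b * Real.exp (y' b)) := by
    intro y y' s
    rw [← Real.log_exp (dist y y'), ← Real.log_mul (Real.exp_pos _).ne'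
      (sum_mul_exp_pos hbin hrow y' s).ne']
    refine Real.log_le_log (sum_mul_exp_pos hbin hrow y s) ?_
    rw [Finset.mul_sum]
    refine Finset.sum_le_sum fun b _ => ?_
    have hA : 0 ≤ A s b := by rcases hbin s b with h | h <;> simp [h]
    rw [mul_left_comm, ← Real.exp_add]
    gcongr
    have := dist_le_pi_dist y y' b
    rw [Real.dist_eq] at this
    have := le_abs_self (y b - y' b)
    linarith
  refine ⟨?_, LipschitzWith.of_dist_le_mul fun y y' => ?_⟩
  · rw [div_lt_one (by exact_mod_cast (by omega : 0 < q))]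
    exact_mod_cast hq
  · refine (dist_pi_le_iff (by positivity)).2 fun s => ?_
    have h1 := key y y' s
    have h2 := key y' y s
    rw [dist_comm y' y] at h2
    rw [Real.dist_eq, logTransfer, logTransfer, ← sub_div, abs_div, abs_of_pos hq0]
    simp only [NNReal.coe_div, NNReal.coe_one, NNReal.coe_natCast]
    rw [div_mul_eq_mul_div, one_mul]
    gcongr
    rw [abs_le]
    constructor <;> linarith

theorem logTransfer_eq_iff (hbin : ∀ i j, A i j = 0 ∨ A i j = 1) (hrow : ∀ i, ∃ j, A i j = 1)
    (hq : 1 < q) (y : Fin m → ℝ) : logTransfer A q y = y ↔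
      ∀ i, Real.exp (y i) ^ q = ∑ j, A i j * Real.exp (y j) := by
  have hq0 : (q : ℝ) ≠ 0 := by
    have : 0 < q := by omega
    positivity
  rw [funext_iff]
  refine forall_congr' fun i => ?_
  rw [logTransfer, div_eq_iff hq0, ← Real.exp_nat_mul, mul_comm (q : ℝ),
    ← Real.exp_injective.eq_iff, Real.exp_log (sum_mul_exp_pos hbin hrow y i), eq_comm]

/-- Links the Banach iteration to the Markov weights: partition sums are sums of exponentials of the
iterates, hence converge. -/
theorem iterate_logTransfer_zero (hbin : ∀ i j, A i j = 0 ∨ A i j = 1)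
    (hrow : ∀ i, ∃ j, A i j = 1) (k : ℕ) (s : Fin m) :
    Real.exp ((logTransfer A q)^[k] 0 s) = transfer A (1 / (q : ℝ)) k s ^ (1 / (q : ℝ)) := by
  induction k generalizing s with
  | zero => simp [transfer]
  | succ k ih =>
    have hpos := sum_mul_exp_pos hbin hrow ((logTransfer A q)^[k] 0) s
    rw [Function.iterate_succ_apply', logTransfer, transfer]
    simp only [← ih]
    rw [Real.rpow_def_of_pos hpos, mul_one_div]

/-- Existence and uniqueness of the positive solution of `t_i ^ q = ∑_j a_{i,j} t_j`, and its
approximation by iterated transfer sums. -/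
theorem exists_unique_fixed_vector (hbin : ∀ i j, A i j = 0 ∨ A i j = 1)
    (hrow : ∀ i, ∃ j, A i j = 1) (hq : 1 < q) :
    ∃ t : Fin m → ℝ, ((∀ i, 0 < t i) ∧ ∀ i, t i ^ q = ∑ j, A i j * t j) ∧
      (∀ s : Fin m → ℝ, (∀ i, 0 < s i) → (∀ i, s i ^ q = ∑ j, A i j * s j) → s = t) ∧
      Tendsto (fun J => partitionSum A (1 / (q : ℝ)) (J + 1)) atTop (𝓝 (∑ i, t i)) := by
  have hc := contractingWith_logTransfer (A := A) hbin hrow hq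
  set y := ContractingWith.fixedPoint (logTransfer A q) hc with hy
  have hfix : logTransfer A q y = y := hc.fixedPoint_isFixedPt
  refine ⟨fun i => Real.exp (y i), ⟨fun i => Real.exp_pos _,
    (logTransfer_eq_iff hbin hrow hq y).1 hfix⟩, fun s hs hsq => ?_, ?_⟩
  · have hexp : ∀ i, Real.exp (Real.log (s i)) = s i := fun i => Real.exp_log (hs i)
    have h1 : logTransfer A q (fun i => Real.log (s i)) = fun i => Real.log (s i) := by
      rw [logTransfer_eq_iff hbin hrow hq]
      simpa only [hexp] using hsq
    have h2 := hc.fixedPoint_unique h1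
    funext i
    rw [hy, ← h2, hexp]
  · have h1 := hc.tendsto_iterate_fixedPoint 0
    rw [tendsto_pi_nhds] at h1
    refine (tendsto_finsetSum _ fun i _ => (Real.continuous_exp.tendsto _).comp (h1 i)).congr
      fun J => ?_
    simp only [partitionSum, Nat.add_sub_cancel, Function.comp]
    exact Finset.sum_congr rfl fun i _ => iterate_logTransfer_zero hbin hrow J i

/-- Every integer is a source, so all starts, of density `(q - 1)/q`, may be given the same class `J
+ 1`; then `J` tends to infinity. -/
theorem ofReal_le_dimH_of_one (hm : 2 ≤ m) (hbin : ∀ i j, A i j = 0 ∨ A i j = 1)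
    (hrow : ∀ i, ∃ j, A i j = 1) (hq : 1 < q) (hne : (shift A 1 q a b).Nonempty) {t : Fin m → ℝ}
    (ht : ∀ i, 0 < t i)
    (hlim : Tendsto (fun J => partitionSum A (1 / (q : ℝ)) (J + 1)) atTop (𝓝 (∑ i, t i))) :
    ENNReal.ofReal (((q : ℝ) - 1) / q * Real.logb m (∑ i, t i)) ≤ dimH (shift A 1 q a b) := by
  have hq0 : (0 : ℝ) < q := by exact_mod_cast (by omega : 0 < q)
  have hbound : ∀ J : ℕ, ENNReal.ofReal (((q : ℝ) - 1) / q
      * Real.logb m (partitionSum A (1 / (q : ℝ)) (J + 1))) ≤ dimH (shift A 1 q a b) := by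
    intro J
    let β : ℕ → ℝ := fun i => if i = J + 1 then ((q : ℝ) - 1) / q else 0
    have h := ofReal_sum_density_mul_logb_le_dimH (a := a) (b := b) (I := J + 1)
      (cls := fun _ => J + 1) (β := β) hm hbin hrow le_rfl hq hne (fun _ => le_rfl)
      (fun u d _ _ => by simp [IsSource])
      (fun i hi => by
        refine HasDensity.starts ?_
        by_cases h1 : i = J + 1
        · subst h1
          have h2 := hasDensity_univ.diff (hasDensity_dvd_sub (by omega : 0 < q) b)
            (Set.subset_univ _)
          simp only [β, if_true]
          convert! h2 using 1
          · ext u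
            simp [IsTarget]
          · field_simp
        · simp only [β, if_neg h1]
          convert! hasDensity_empty using 1
          ext u
          simp [Ne.symm h1])
    refine le_of_eq_of_le (congrArg _ ?_) h
    rw [Finset.sum_eq_single (J + 1)]
    · simp [β]
    · intro i _ hi
      simp [β, hi]
    · intro hh
      exact absurd (Finset.mem_Icc.2 ⟨by omega, le_rfl⟩) hh
  have : Nonempty (Fin m) := ⟨⟨0, by omega⟩⟩
  have hpos : 0 < ∑ i, t i := Finset.sum_pos (fun i _ => ht i) Finset.univ_nonempty
  have hlog : Tendsto (fun J => Real.logb m (partitionSum A (1 / (q : ℝ)) (J + 1))) atTop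
      (𝓝 (Real.logb m (∑ i, t i))) :=
    Tendsto.div_const ((Real.continuousAt_log hpos.ne').tendsto.comp hlim) _
  exact le_of_tendsto' (ENNReal.tendsto_ofReal (hlog.const_mul _)) hbound

end AffineShift

/-! ### Densities of chain lengths when the gcd divides `b - a`. -/

namespace AffineShift

variable {m p q : ℕ} {a b : ℤ} {A : Matrix (Fin m) (Fin m) ℝ}

/-- The chain that starts at `z` has exactly `i` members (`i ≥ 1`). -/
def HasLength (p q : ℕ) (a b : ℤ) (i : ℕ) (z : ℤ) : Prop :=
  (∀ e < i - 1, IsSource p a (orbit p q a b e z)) ∧ ¬ IsSource p a (orbit p q a b (i - 1) z)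

theorem HasLength.unique {i i' : ℕ} {z : ℤ} (hi : 1 ≤ i) (hi' : 1 ≤ i')
    (h : HasLength p q a b i z) (h' : HasLength p q a b i' z) : i = i' := by
  rcases lt_trichotomy i i' with hlt | heq | hlt
  · exact absurd (h'.1 (i - 1) (by omega)) h.2
  · exact heq
  · exact absurd (h.1 (i' - 1) (by omega)) h'.2

/-- Chains of more than `I` members get class `0`, that is, a deterministic word; they merely
contribute no entropy. -/
theorem dimH_ge_sum_of_hasLength_density (hm : 2 ≤ m) (hbin : ∀ i j, A i j = 0 ∨ A i j = 1)
    (hrow : ∀ i, ∃ j, A i j = 1) (hp : 1 ≤ p) (hpq : p < q)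
    (hne : (shift A p q a b).Nonempty) {β : ℕ → ℝ}
    (hβ : ∀ i, 1 ≤ i → HasDensity {u : ℕ | ¬ IsTarget q b u ∧ HasLength p q a b i u} (β i)) (I : ℕ) :
    ENNReal.ofReal (∑ i ∈ Finset.Icc 1 I, β i * Real.logb m (partitionSum A ((p : ℝ) / q) i))
      ≤ dimH (shift A p q a b) := by
  classical
  let cls : ℕ → ℕ := fun u => if h : ∃ i, 1 ≤ i ∧ i ≤ I ∧ HasLength p q a b i u then h.choose else 0
  have hcls : ∀ u i : ℕ, 1 ≤ i → i ≤ I → (cls u = i ↔ HasLength p q a b i u) := by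
    intro u i hi hiI
    constructor
    · intro h
      simp only [cls] at h
      split_ifs at h with hex
      · rw [← h]
        exact hex.choose_spec.2.2
      · omega
    · intro h
      have hex : ∃ i, 1 ≤ i ∧ i ≤ I ∧ HasLength p q a b i u := ⟨i, hi, hiI, h⟩
      simp only [cls]
      rw [dif_pos hex]
      exact HasLength.unique hex.choose_spec.1 hi hex.choose_spec.2.2 h
  have hI : ∀ u, cls u ≤ I := by
    intro u
    simp only [cls]
    split_ifs with hex
    · exact hex.choose_spec.2.1
    · exact Nat.zero_le I
  refine ofReal_sum_density_mul_logb_le_dimH hm hbin hrow hp hpq hne hI (fun u d _ hd => ?_)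
    (fun i hi => HasDensity.starts ?_)
  · exact ((hcls u (cls u) (by omega) (hI u)).1 rfl).1 d (by omega)
  · obtain ⟨h1, h2⟩ := Finset.mem_Icc.1 hi
    simpa only [hcls _ i h1 h2] using hβ i h1

/-- Bézout inverts `α` modulo `N`, so the condition is one residue class of `w` modulo `N`, hence
one of `u` modulo `g N`. -/
theorem hasDensity_affine {g N : ℕ} (hg : 0 < g) (hN : 0 < N) (a α κ : ℤ) (hα : IsCoprime α (N : ℤ)) :
    HasDensity {u : ℕ | ∃ w : ℤ, (u : ℤ) = a + g * w ∧ (N : ℤ) ∣ α * w + κ} (1 / ((g : ℝ) * N)) := by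
  obtain ⟨s, t, hst⟩ := hα
  have hd := hasDensity_dvd_sub (Nat.mul_pos hg hN) (a + g * (-(s * κ)))
  have hg0 : (g : ℤ) ≠ 0 := by omega
  push_cast at hd
  convert! hd using 1
  ext u
  simp only [Set.mem_ofPred_eq]
  constructor
  · rintro ⟨w, hw, k, hk⟩
    rw [hw]
    refine ⟨t * w + s * k, ?_⟩
    have h1 : w = s * (α * w) + t * N * w := by linear_combination (-w) * hst
    have h2 : s * (α * w) = s * (N * k) - s * κ := by rw [← hk]; ring
    linear_combination (g : ℤ) * h1 + (g : ℤ) * h2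
  · rintro ⟨k, hk⟩
    refine ⟨-(s * κ) + N * k, by linear_combination hk, α * k + t * κ, ?_⟩
    linear_combination (-κ) * hst

/-- The quantity `(q₁ - p₁) w + p₁ c`, multiplied by `q₁ / p₁` along each constraint between
positions `a + g w`. -/
def displacement (p₁ q₁ : ℕ) (c w : ℤ) : ℤ := ((q₁ : ℤ) - p₁) * w + p₁ * c

section Arithmetic

variable {g p₁ q₁ : ℕ} {c : ℤ}

theorem isSource_iff_dvd_displacement (hg : 0 < g) (hcop : Nat.Coprime p₁ q₁) (w : ℤ) :
    IsSource (g * p₁) a (a + g * w) ↔ (p₁ : ℤ) ∣ displacement p₁ q₁ c w := by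
  have hg0 : (g : ℤ) ≠ 0 := by omega
  have hcop' : IsCoprime (p₁ : ℤ) ((q₁ : ℤ) - p₁) := by
    have := (Nat.isCoprime_iff_coprime.2 hcop)
    simpa [sub_eq_add_neg] using (IsCoprime.add_mul_left_right_iff (z := (-1 : ℤ))).2 this
  rw [IsSource, displacement, add_sub_cancel_left]
  push_cast
  rw [mul_dvd_mul_iff_left hg0, dvd_add_left (dvd_mul_right _ _)]
  exact ⟨fun h => h.mul_left _, fun h => hcop'.dvd_of_dvd_mul_left h⟩

theorem isTarget_iff_dvd_displacement (hg : 0 < g) (hcop : Nat.Coprime p₁ q₁) (w : ℤ) :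
    IsTarget (g * q₁) (a + g * c) (a + g * w) ↔ (q₁ : ℤ) ∣ displacement p₁ q₁ c w := by
  have hg0 : (g : ℤ) ≠ 0 := by omega
  have hcop' : IsCoprime (q₁ : ℤ) (p₁ : ℤ) := (Nat.isCoprime_iff_coprime.2 hcop).symm
  have h1 : a + g * w - (a + g * c) = g * (w - c) := by ring
  have h2 : displacement p₁ q₁ c w = q₁ * w - p₁ * (w - c) := by rw [displacement]; ring
  rw [IsTarget, h1, h2]
  push_cast
  rw [mul_dvd_mul_iff_left hg0, dvd_sub_right (dvd_mul_right _ _)]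
  exact ⟨fun h => h.mul_left _, fun h => hcop'.dvd_of_dvd_mul_left h⟩

/-- A step replaces a displacement `p₁ X` by `q₁ X`. As `q₁` is prime to `p₁`, it removes exactly
one factor `p₁`, so surviving `n` steps is divisibility by `p₁^n`. -/
theorem forall_isSource_iff_pow_dvd (hg : 0 < g) (hp₁ : 0 < p₁) (hcop : Nat.Coprime p₁ q₁) (n : ℕ)
    (w : ℤ) :
    (∀ e < n, IsSource (g * p₁) a (orbit (g * p₁) (g * q₁) a (a + g * c) e (a + g * w))) ↔
      (p₁ : ℤ) ^ n ∣ displacement p₁ q₁ c w := by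
  have hp0 : (p₁ : ℤ) ≠ 0 := by omega
  have hg0 : (g : ℤ) ≠ 0 := by omega
  induction n generalizing w with
  | zero => simp
  | succ n ih =>
    have hsplit : (∀ e < n + 1, IsSource (g * p₁) a
          (orbit (g * p₁) (g * q₁) a (a + g * c) e (a + g * w))) ↔
        IsSource (g * p₁) a (a + g * w) ∧ ∀ e < n, IsSource (g * p₁) a
          (orbit (g * p₁) (g * q₁) a (a + g * c) e
            (next (g * p₁) (g * q₁) a (a + g * c) (a + g * w))) := by
      constructor
      · exact fun h => ⟨h 0 (Nat.succ_pos n), fun e he => h (e + 1) (by omega)⟩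
      · rintro ⟨h1, h2⟩ e he
        cases e with
        | zero => exact h1
        | succ e => exact h2 e (by omega)
    rw [hsplit]
    by_cases hs : IsSource (g * p₁) a (a + g * w)
    · obtain ⟨k, hk⟩ := id hs
      have hw : w = p₁ * k := by
        have : (g : ℤ) * w = g * (p₁ * k) := by push_cast at hk; linear_combination hk
        exact mul_left_cancel₀ hg0 this
      have hn : next (g * p₁) (g * q₁) a (a + g * c) (a + g * w) = a + g * (q₁ * k + c) := by
        rw [next, hk, Int.mul_ediv_cancel_left _ (by push_cast; positivity)]
        push_cast
        ring
      have hd1 : displacement p₁ q₁ c w = p₁ * (((q₁ : ℤ) - p₁) * k + c) := by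
        rw [displacement, hw]; ring
      have hd2 : displacement p₁ q₁ c (q₁ * k + c) = q₁ * (((q₁ : ℤ) - p₁) * k + c) := by
        rw [displacement]; ring
      have hcop' : IsCoprime ((p₁ : ℤ) ^ n) (q₁ : ℤ) :=
        (Nat.isCoprime_iff_coprime.2 hcop).pow_left
      rw [hn]
      refine (and_congr_right fun _ => ih (q₁ * k + c)).trans ?_
      rw [hd1, hd2, pow_succ', mul_dvd_mul_iff_left hp0]
      simp only [hs, true_and]
      exact ⟨fun h => hcop'.dvd_of_dvd_mul_left h, fun h => h.mul_left _⟩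
    · have h2 : ¬ (p₁ : ℤ) ^ (n + 1) ∣ displacement p₁ q₁ c w := fun h =>
        hs ((isSource_iff_dvd_displacement hg hcop w).2 ((dvd_pow_self _ (Nat.succ_ne_zero n)).trans h))
      simp [hs, h2]

/-- The density of the first members of chains with exactly `i` members. -/
noncomputable def startDensity (g p₁ q₁ i : ℕ) : ℝ :=
  (if i = 1 then 1 else 1 / ((g : ℝ) * p₁ ^ (i - 1))) - 1 / ((g : ℝ) * p₁ ^ i)
    - (1 / ((g : ℝ) * (p₁ ^ (i - 1) * q₁)) - 1 / ((g : ℝ) * (p₁ ^ i * q₁)))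

theorem startDensity_one (g p₁ q₁ : ℕ) : startDensity g p₁ q₁ 1
    = 1 - 1 / ((g : ℝ) * p₁) - 1 / ((g : ℝ) * q₁) + 1 / ((g : ℝ) * p₁ * q₁) := by
  simp [startDensity]
  ring

theorem startDensity_of_two_le (hg : 0 < g) (hp₁ : 0 < p₁) (hq₁ : 0 < q₁) {i : ℕ} (hi : 2 ≤ i) :
    startDensity g p₁ q₁ i
      = ((q₁ : ℝ) - 1) / ((g : ℝ) * q₁) * (((p₁ : ℝ) - 1) / (p₁ : ℝ) ^ i) := by
  obtain ⟨k, rfl⟩ : ∃ k, i = k + 1 := ⟨i - 1, by omega⟩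
  rw [startDensity, if_neg (by omega), Nat.add_sub_cancel]
  have h1 : (g : ℝ) ≠ 0 := by positivity
  have h2 : (p₁ : ℝ) ≠ 0 := by positivity
  have h3 : (q₁ : ℝ) ≠ 0 := by positivity
  field_simp
  ring

/-- Length `i` means that `p₁^(i-1)` but not `p₁^i` is available, and being a target is divisibility
of the displacement by `q₁`. Coprimality makes the two kinds of conditions combine into single
moduli, and inclusion-exclusion gives `startDensity`. -/
theorem hasDensity_hasLength (hg : 0 < g) (hp₁ : 0 < p₁) (hq₁ : 0 < q₁)
    (hcop : Nat.Coprime p₁ q₁) {i : ℕ} (hi : 1 ≤ i) :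
    HasDensity {u : ℕ | ¬ IsTarget (g * q₁) (a + g * c) u ∧
      HasLength (g * p₁) (g * q₁) a (a + g * c) i u} (startDensity g p₁ q₁ i) := by
  have hcopq : IsCoprime (p₁ : ℤ) (q₁ : ℤ) := Nat.isCoprime_iff_coprime.2 hcop
  have hc1 : IsCoprime ((q₁ : ℤ) - p₁) (p₁ : ℤ) := by
    simpa [sub_eq_add_neg] using (IsCoprime.add_mul_left_left_iff (z := (-1 : ℤ))).2 hcopq.symm
  have hc2 : IsCoprime ((q₁ : ℤ) - p₁) (q₁ : ℤ) := by
    have := (IsCoprime.add_mul_left_left_iff (z := (1 : ℤ))).2 hcopq.neg_left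
    simpa [neg_add_eq_sub] using this
  let src : ℕ → Set ℕ := fun n =>
    {u : ℕ | ∀ e < n, IsSource (g * p₁) a (orbit (g * p₁) (g * q₁) a (a + g * c) e u)}
  let tgt : Set ℕ := {u : ℕ | IsTarget (g * q₁) (a + g * c) u}
  have hform_src : ∀ u : ℕ, IsSource (g * p₁) a u → ∃ w : ℤ, (u : ℤ) = a + g * w := by
    rintro u ⟨k, hk⟩
    refine ⟨p₁ * k, ?_⟩
    push_cast at hk
    linear_combination hk
  have hform_tgt : ∀ u : ℕ, u ∈ tgt → ∃ w : ℤ, (u : ℤ) = a + g * w := by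
    rintro u ⟨k, hk⟩
    refine ⟨q₁ * k + c, ?_⟩
    push_cast at hk
    linear_combination hk
  have hsrc : ∀ n, HasDensity (src n) (if n = 0 then 1 else 1 / ((g : ℝ) * p₁ ^ n)) := by
    intro n
    -- For `n = 0` there is no condition, not even membership in the progression `a + gℤ`; this is
    -- why length one has its own formula.
    by_cases hn : n = 0
    · subst hn
      have : src 0 = Set.univ := by ext; simp [src]
      rw [this, if_pos rfl]
      exact hasDensity_univ
    · rw [if_neg hn]
      have h1 := hasDensity_affine hg (pow_pos hp₁ n) a ((q₁ : ℤ) - p₁) (p₁ * c)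
        (by push_cast; exact hc1.pow_right)
      push_cast at h1
      convert! h1 using 1
      ext u
      simp only [src, Set.mem_ofPred_eq]
      constructor
      · intro h
        obtain ⟨w, hw⟩ := hform_src u (h 0 (by omega))
        rw [hw] at h
        exact ⟨w, hw, (forall_isSource_iff_pow_dvd hg hp₁ hcop n w).1 h⟩
      · rintro ⟨w, hw, h⟩
        rw [hw]
        exact (forall_isSource_iff_pow_dvd hg hp₁ hcop n w).2 h
  have htgt : ∀ n, HasDensity (tgt ∩ src n) (1 / ((g : ℝ) * (p₁ ^ n * q₁))) := by
    intro n
    have h1 := hasDensity_affine hg (Nat.mul_pos (pow_pos hp₁ n) hq₁) a ((q₁ : ℤ) - p₁) (p₁ * c)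
      (by push_cast; exact hc1.pow_right.mul_right hc2)
    push_cast at h1
    convert! h1 using 1
    ext u
    simp only [Set.mem_inter_iff, Set.mem_ofPred_eq]
    constructor
    · rintro ⟨ht, hs⟩
      obtain ⟨w, hw⟩ := hform_tgt u ht
      simp only [tgt, src, Set.mem_ofPred_eq] at ht hs
      rw [hw] at ht hs
      exact ⟨w, hw, hcopq.pow_left.mul_dvd ((forall_isSource_iff_pow_dvd hg hp₁ hcop n w).1 hs)
        ((isTarget_iff_dvd_displacement hg hcop w).1 ht)⟩
    · rintro ⟨w, hw, h⟩
      simp only [tgt, src, Set.mem_ofPred_eq]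
      rw [hw]
      exact ⟨(isTarget_iff_dvd_displacement hg hcop w).2 ((dvd_mul_left _ _).trans h),
        (forall_isSource_iff_pow_dvd hg hp₁ hcop n w).2 ((dvd_mul_right _ _).trans h)⟩
  have hsub : src i ⊆ src (i - 1) := fun u hu e he => hu e (by omega)
  have hd := ((hsrc (i - 1)).diff (hsrc i) hsub).diff
    ((htgt (i - 1)).diff (htgt i) (Set.inter_subset_inter_right _ hsub))
    (fun u hu => ⟨hu.1.2, fun h => hu.2 ⟨hu.1.1, h⟩⟩)
  have hi0 : i - 1 = 0 ↔ i = 1 := by omega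
  have hi1 : i ≠ 0 := by omega
  simp only [hi0] at hd
  rw [if_neg hi1] at hd
  convert! hd using 1
  ext u
  have hlen : HasLength (g * p₁) (g * q₁) a (a + g * c) i u ↔ u ∈ src (i - 1) ∧ u ∉ src i := by
    refine and_congr_right fun h => not_congr ?_
    constructor
    · intro h1 e he
      rcases (by omega : e < i - 1 ∨ e = i - 1) with h2 | rfl
      · exact h e h2
      · exact h1
    · exact fun h1 => h1 (i - 1) (by omega)
  simp only [Set.mem_ofPred_eq, Set.mem_sdiff, Set.mem_inter_iff, hlen]
  have : IsTarget (g * q₁) (a + g * c) u ↔ u ∈ tgt := Iff.rfl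
  rw [this]
  tauto

end Arithmetic

end AffineShift

/-! ### Counting chains through their starts. -/

namespace AffineShift

variable {p q : ℕ} {a b : ℤ}

/-- The chain of a natural number, meaningful for positive ones. -/
def natChain (p q : ℕ) (a b : ℤ) (u : ℕ) : Set ℕ+ := chain p q a b u.toPNat'

/-- The `d`-th member of the chain that starts at `u`, as a position. -/
def member (p q : ℕ) (a b : ℤ) (u d : ℕ) : ℕ+ := (orbit p q a b d u).toNat.toPNat'

theorem chain_eq_of_mem {u v : ℕ+} (h : v ∈ chain p q a b u) :
    chain p q a b v = chain p q a b u := by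
  ext w
  exact ⟨fun hw => Relation.EqvGen.trans _ _ _ h hw,
    fun hw => Relation.EqvGen.trans _ _ _ (Relation.EqvGen.symm _ _ h) hw⟩

theorem self_mem_chain (u : ℕ+) : u ∈ chain p q a b u := Relation.EqvGen.refl u

theorem coe_toPNat' {u : ℕ} (h : 0 < u) : ((u.toPNat' : ℕ+) : ℕ) = u := by
  simp [h]

theorem pos_of_isStart (hq : 1 ≤ q) {u : ℕ} (hu : threshold q a b ≤ u) : 0 < u := by
  have := threshold_pos (a := a) (b := b) hq
  omega

theorem coe_member (hp : 1 ≤ p) (hpq : p < q) {u d : ℕ} (hu : threshold q a b ≤ u)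
    (h : ∀ e < d, IsSource p a (orbit p q a b e u)) :
    ((member p q a b u d : ℕ) : ℤ) = orbit p q a b d u := by
  have h1 := le_orbit hp hpq hu h
  have h2 := threshold_pos (a := a) (b := b) (by omega : 1 ≤ q)
  rw [member, coe_toPNat' (by omega), Int.toNat_of_nonneg (by omega)]

theorem member_mem_natChain (hp : 1 ≤ p) (hpq : p < q) {u d : ℕ} (hu : threshold q a b ≤ u)
    (h : ∀ e < d, IsSource p a (orbit p q a b e u)) :
    member p q a b u d ∈ natChain p q a b u := by
  induction d with
  | zero =>
    have : member p q a b u 0 = u.toPNat' := by simp [member, orbit_zero]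
    rw [this]
    exact self_mem_chain _
  | succ d ih =>
    have h' : ∀ e < d, IsSource p a (orbit p q a b e u) := fun e he => h e (by omega)
    refine Relation.EqvGen.trans _ _ _ (ih h') (Relation.EqvGen.rel _ _ ?_)
    have h1 := coe_member hp hpq hu h'
    refine linked_of_isSource hp hpq ?_ ?_ ?_
    · rw [h1]; exact hu.trans (le_orbit hp hpq hu h')
    · rw [h1]; exact h d (by omega)
    · rw [h1, coe_member hp hpq hu h, orbit_succ]

theorem natChain_eq_image (hp : 1 ≤ p) (hpq : p < q) {u i : ℕ} (hi : 1 ≤ i)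
    (hu : IsStart q a b u) (hlen : HasLength p q a b i u) :
    natChain p q a b u = member p q a b u '' {d | d < i} := by
  have hpos : 0 < u := pos_of_isStart (by omega) hu.1
  have hsrc : ∀ d < i, ∀ e < d, IsSource p a (orbit p q a b e u) := fun d hd e he =>
    hlen.1 e (by omega)
  ext v
  constructor
  · intro hv
    -- Being one of the first `i` orbit points is invariant under links in both directions: the last
    -- point is no source and the first is no target.
    let M : ℕ+ → Prop := fun x => ∃ d < i, orbit p q a b d u = (x : ℕ)
    have hM : ∀ x y : ℕ+, Linked p q a b x y → (M x ↔ M y) := by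
      intro x y hxy
      obtain ⟨hs, hn⟩ := next_eq_of_linked hp hxy
      constructor
      · rintro ⟨d, hd, hdx⟩
        rcases (by omega : d = i - 1 ∨ d + 1 < i) with rfl | hd'
        · exact absurd (hdx ▸ hs) hlen.2
        · exact ⟨d + 1, hd', by rw [orbit_succ, hdx, hn]⟩
      · rintro ⟨d, hd, hdy⟩
        cases d with
        | zero =>
          refine absurd ?_ hu.2
          rw [orbit_zero] at hdy
          rw [hdy, ← hn]
          exact isTarget_next _
        | succ d =>
          refine ⟨d, by omega, ?_⟩
          apply next_injOn (q := q) (b := b) hp (by omega) (hlen.1 d (by omega)) hs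
          rw [← orbit_succ, hdy, hn]
    have hEq : ∀ x y : ℕ+, Relation.EqvGen (Linked p q a b) x y → (M x ↔ M y) := by
      intro x y h
      induction h with
      | rel x y h => exact hM x y h
      | refl x => exact Iff.rfl
      | symm x y _ ih => exact ih.symm
      | trans x y z _ _ ih1 ih2 => exact ih1.trans ih2
    obtain ⟨d, hd, hdv⟩ := (hEq _ _ hv).1 ⟨0, by omega, by rw [orbit_zero, coe_toPNat' hpos]⟩
    refine ⟨d, hd, ?_⟩
    apply PNat.coe_injective
    have := coe_member hp hpq hu.1 (hsrc d hd)
    rw [hdv] at this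
    exact_mod_cast this
  · rintro ⟨d, hd, rfl⟩
    exact member_mem_natChain hp hpq hu.1 (hsrc d hd)

theorem member_injOn (hp : 1 ≤ p) (hpq : p < q) {u i : ℕ} (hu : threshold q a b ≤ u)
    (hsrc : ∀ d < i, ∀ e < d, IsSource p a (orbit p q a b e u)) :
    Set.InjOn (member p q a b u) {d | d < i} := by
  intro d hd d' hd' h
  have h1 := coe_member hp hpq hu (hsrc d hd)
  have h2 := coe_member hp hpq hu (hsrc d' hd')
  rw [h, h2] at h1
  rcases lt_trichotomy d d' with hlt | heq | hlt
  · exact absurd h1 (orbit_lt_orbit hp hpq hu (hsrc d' hd') hlt).ne'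
  · exact heq
  · exact absurd h1 (orbit_lt_orbit hp hpq hu (hsrc d hd) hlt).ne

theorem encard_natChain (hp : 1 ≤ p) (hpq : p < q) {u i : ℕ} (hi : 1 ≤ i)
    (hu : IsStart q a b u) (hlen : HasLength p q a b i u) :
    (natChain p q a b u).encard = i := by
  have hsrc : ∀ d < i, ∀ e < d, IsSource p a (orbit p q a b e u) := fun d hd e he =>
    hlen.1 e (by omega)
  have hset : {d | d < i} = ((Finset.range i : Finset ℕ) : Set ℕ) := by ext; simp
  rw [natChain_eq_image hp hpq hi hu hlen, (member_injOn hp hpq hu.1 hsrc).encard_image, hset,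
    Set.encard_coe_eq_coe_finsetCard, Finset.card_range]

theorem encard_natChain_inter_eq_iff (hp : 1 ≤ p) (hpq : p < q) {u i j n : ℕ} (hj : 1 ≤ j)
    (hji : j ≤ i) (hu : IsStart q a b u) (hlen : HasLength p q a b i u) :
    (natChain p q a b u ∩ {v : ℕ+ | (v : ℕ) ≤ n}).encard = j ↔
      orbit p q a b (j - 1) u ≤ n ∧ ¬ (j < i ∧ orbit p q a b j u ≤ n) := by
  classical
  have hsrc : ∀ d < i, ∀ e < d, IsSource p a (orbit p q a b e u) := fun d hd e he =>
    hlen.1 e (by omega)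
  obtain ⟨k, hk, hf⟩ := exists_filter_range_eq_range (fun d => orbit p q a b d u ≤ n) i
    (fun d e hde hei he => by
      rcases hde.eq_or_lt with rfl | hlt
      · exact he
      · exact (orbit_lt_orbit hp hpq hu.1 (hsrc e hei) hlt).le.trans he)
  have hmem : ∀ d, d < k ↔ d < i ∧ orbit p q a b d u ≤ n := by
    intro d
    rw [← Finset.mem_range, ← hf, Finset.mem_filter, Finset.mem_range]
  have himg : natChain p q a b u ∩ {v : ℕ+ | (v : ℕ) ≤ n}
      = member p q a b u '' ((Finset.range k : Finset ℕ) : Set ℕ) := by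
    rw [natChain_eq_image hp hpq (by omega) hu hlen]
    ext v
    constructor
    · rintro ⟨⟨d, hd, rfl⟩, hv⟩
      refine ⟨d, ?_, rfl⟩
      have h1 := coe_member hp hpq hu.1 (hsrc d hd)
      simp only [Set.mem_ofPred_eq] at hv
      have : d < k := (hmem d).2 ⟨hd, by omega⟩
      simpa using this
    · rintro ⟨d, hd, rfl⟩
      have hd' := (hmem d).1 (by simpa using hd)
      refine ⟨⟨d, hd'.1, rfl⟩, ?_⟩
      have h1 := coe_member hp hpq hu.1 (hsrc d hd'.1)
      simp only [Set.mem_ofPred_eq]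
      omega
  have hinj : Set.InjOn (member p q a b u) ((Finset.range k : Finset ℕ) : Set ℕ) :=
    (member_injOn hp hpq hu.1 hsrc).mono fun d hd => by
      have : d < k := by simpa using hd
      exact lt_of_lt_of_le this hk
  rw [himg, hinj.encard_image, Set.encard_coe_eq_coe_finsetCard, Finset.card_range]
  have hkj : ((k : ℕ∞) = j) ↔ k = j := by exact_mod_cast Iff.rfl
  -- The `j`-th member has depth `j - 1`; exactly `j` members are counted when that depth qualifies
  -- and depth `j` does not.
  rw [hkj, ← hmem j]
  constructor
  · rintro rfl
    exact ⟨((hmem (k - 1)).1 (by omega)).2, lt_irrefl _⟩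
  · rintro ⟨h1, h2⟩
    have := (hmem (j - 1)).2 ⟨by omega, h1⟩
    omega

/-- A finite chain beyond the threshold is the chain of a start. -/
theorem exists_start_of_chain (hp : 1 ≤ p) (hpq : p < q) {U : Set ℕ+} {i : ℕ}
    (hU : U ∈ chains p q a b i) (hbig : ∀ v ∈ U, threshold q a b ≤ (v : ℕ)) :
    ∃ u : ℕ, IsStart q a b u ∧ HasLength p q a b i u ∧ U = natChain p q a b u := by
  obtain ⟨⟨w, rfl⟩, hcard⟩ := hU
  set U := chain p q a b w with hUdef
  have hne : U.Nonempty := ⟨w, self_mem_chain w⟩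
  set u : ℕ+ := wellFounded_lt.min U hne with hu
  have huU : u ∈ U := wellFounded_lt.min_mem U hne
  have hmin : ∀ v ∈ U, u ≤ v := fun v hv => not_lt.1 (wellFounded_lt.not_lt_min U hv)
  have hchain : chain p q a b u = U := chain_eq_of_mem huU
  have hnat : natChain p q a b u = U := by
    rw [natChain, ← hchain]
    simp
  have hth := hbig u huU
  -- If the least member were a target, its predecessor would lie in the chain and be smaller.
  have hstart : IsStart q a b (u : ℕ) := by
    refine ⟨hth, fun ht => ?_⟩
    obtain ⟨u', hlink⟩ := exists_linked_of_isTarget (a := a) hp hpq hth ht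
    have hu' : u' ∈ U := by
      rw [← hchain]
      exact Relation.EqvGen.symm _ _ (Relation.EqvGen.rel _ _ hlink)
    obtain ⟨hs, hn⟩ := next_eq_of_linked hp hlink
    obtain ⟨-, -, -, -, hlt⟩ := exists_of_isSource (b := b) hp hpq (hbig u' hu') hs
    rw [hn] at hlt
    have : u' < u := by exact_mod_cast hlt
    exact absurd (hmin u' hu') (not_le.2 this)
  -- Otherwise the first `i + 1` orbit points would be distinct members of a chain with `i` members.
  have hexists : ∃ e, ¬ IsSource p a (orbit p q a b e (u : ℕ)) := by
    by_contra! hall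
    have hinj : Set.InjOn (member p q a b u) {d | d < i + 1} :=
      member_injOn hp hpq hth fun d _ e _ => hall e
    have hsub : member p q a b u '' {d | d < i + 1} ⊆ U := by
      rintro _ ⟨d, -, rfl⟩
      rw [← hnat]
      exact member_mem_natChain hp hpq hth fun e _ => hall e
    have h1 := Set.encard_le_encard hsub
    have hset : {d | d < i + 1} = ((Finset.range (i + 1) : Finset ℕ) : Set ℕ) := by ext; simp
    rw [hinj.encard_image, hset, Set.encard_coe_eq_coe_finsetCard, Finset.card_range, hcard] at h1
    have : i + 1 ≤ i := by exact_mod_cast h1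
    omega
  classical
  have hlen : HasLength p q a b (Nat.find hexists + 1) (u : ℕ) :=
    ⟨fun e he => not_not.1 (Nat.find_min hexists (by omega)), Nat.find_spec hexists⟩
  have h1 := encard_natChain hp hpq (by omega) hstart hlen
  rw [hnat, hcard] at h1
  have h2 : i = Nat.find hexists + 1 := by exact_mod_cast h1
  rw [← h2] at hlen
  exact ⟨u, hstart, hlen, hnat.symm⟩

theorem natChain_injOn (hp : 1 ≤ p) (hpq : p < q) {i : ℕ} (hi : 1 ≤ i) :
    Set.InjOn (natChain p q a b) {u : ℕ | IsStart q a b u ∧ HasLength p q a b i u} := by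
  rintro u ⟨hu, hlen⟩ u' ⟨hu', hlen'⟩ h
  have hmem : member p q a b u 0 ∈ natChain p q a b u :=
    member_mem_natChain hp hpq hu.1 fun e he => by omega
  rw [h, natChain_eq_image hp hpq hi hu' hlen'] at hmem
  obtain ⟨d, hd, hdu⟩ := hmem
  have hs : ∀ e < d, IsSource p a (orbit p q a b e u') := fun e he =>
    hlen'.1 e (by have : d < i := hd; omega)
  have h1 := coe_member hp hpq hu'.1 hs
  have h2 := coe_member (b := b) (d := 0) hp hpq hu.1 fun e he => by omega
  rw [hdu, h2] at h1
  have := (IsMember.unique hp hpq hu hu' ⟨fun e he => by omega, rfl⟩ ⟨hs, h1.symm⟩).1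
  exact_mod_cast this

open Classical in
/-- The starts of chains with `i` members whose `d`-th member exists and is at most `n`. -/
noncomputable def startsUpTo (p q : ℕ) (a b : ℤ) (i d n : ℕ) : Finset ℕ :=
  if d < i then (Finset.range (cutoff p q a b d n)).filter
    fun u => IsStart q a b u ∧ HasLength p q a b i u else ∅

theorem mem_startsUpTo (hp : 1 ≤ p) (hpq : p < q) {i d n u : ℕ} :
    u ∈ startsUpTo p q a b i d n ↔ d < i ∧ (IsStart q a b u ∧ HasLength p q a b i u) ∧
      orbit p q a b d u ≤ n := by
  classical
  rw [startsUpTo]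
  split_ifs with hd
  · rw [Finset.mem_filter, Finset.mem_range]
    constructor
    · rintro ⟨h1, h2⟩
      exact ⟨hd, h2, (orbit_le_iff_lt_cutoff hp hpq (fun e he => h2.2.1 e (by omega)) n).2 h1⟩
    · rintro ⟨-, h2, h1⟩
      exact ⟨(orbit_le_iff_lt_cutoff hp hpq (fun e he => h2.2.1 e (by omega)) n).1 h1, h2⟩
  · simp [hd]

theorem tendsto_card_startsUpTo_div (hp : 1 ≤ p) (hpq : p < q) {i : ℕ} {β : ℝ}
    (hβ : HasDensity {u : ℕ | ¬ IsTarget q b u ∧ HasLength p q a b i u} β) (d : ℕ) :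
    Tendsto (fun n : ℕ => ((startsUpTo p q a b i d n).card : ℝ) / n) atTop
      (𝓝 (if d < i then β * ((p : ℝ) / q) ^ d else 0)) := by
  classical
  by_cases hd : d < i
  · simp only [startsUpTo, if_pos hd]
    have h1 := (HasDensity.starts (a := a) hβ).comp (tendsto_cutoff hp hpq a b d)
    refine (h1.mul (tendsto_cutoff_div p q a b d)).congr' ?_
    filter_upwards [(tendsto_cutoff hp hpq a b d).eventually_gt_atTop 0] with n hn
    have : ((cutoff p q a b d n : ℕ) : ℝ) ≠ 0 := by positivity
    simp only [Function.comp]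
    rw [Finset.card_filter, Nat.cast_sum, div_mul_div_cancel₀ this]
    congr 1
    refine Finset.sum_congr rfl fun u _ => ?_
    by_cases hu : IsStart q a b u ∧ HasLength p q a b i u
    · rw [if_pos hu, Set.indicator_of_mem (by exact hu)]; simp
    · rw [if_neg hu, Set.indicator_of_notMem (by exact hu)]; simp
  · simp [startsUpTo, hd]

/-- Chains lying beyond the threshold are counted exactly by their starts. Any other chain has a
member below the threshold, so the error is bounded independently of `n`. -/
theorem abs_chainCount_sub_le (hp : 1 ≤ p) (hpq : p < q) {i j : ℕ} (hj : 1 ≤ j) (hji : j ≤ i)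
    (n : ℕ) :
    |(chainCount p q a b i n j : ℝ) - (((startsUpTo p q a b i (j - 1) n).card : ℝ)
      - (startsUpTo p q a b i j n).card)| ≤ (threshold q a b).toNat := by
  set N := (threshold q a b).toNat with hN
  set F := startsUpTo p q a b i (j - 1) n \ startsUpTo p q a b i j n with hF
  have hsub : startsUpTo p q a b i j n ⊆ startsUpTo p q a b i (j - 1) n := by
    intro u hu
    rw [mem_startsUpTo hp hpq] at hu ⊢
    refine ⟨by omega, hu.2.1, ?_⟩
    exact (orbit_lt_orbit hp hpq hu.2.1.1.1 (fun e he => hu.2.1.2.1 e (by omega))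
      (by omega : j - 1 < j)).le.trans hu.2.2
  have hFcard : (F.card : ℝ) = (startsUpTo p q a b i (j - 1) n).card
      - (startsUpTo p q a b i j n).card := by
    rw [hF, Finset.card_sdiff_of_subset hsub, Nat.cast_sub (Finset.card_le_card hsub)]
  have hmemF : ∀ u, u ∈ F ↔ (IsStart q a b u ∧ HasLength p q a b i u) ∧
      (natChain p q a b u ∩ {v : ℕ+ | (v : ℕ) ≤ n}).encard = j := by
    intro u
    rw [hF, Finset.mem_sdiff, mem_startsUpTo hp hpq, mem_startsUpTo hp hpq]
    constructor
    · rintro ⟨⟨-, h1, h2⟩, h3⟩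
      exact ⟨h1, (encard_natChain_inter_eq_iff hp hpq hj hji h1.1 h1.2).2
        ⟨h2, fun h4 => h3 ⟨h4.1, h1, h4.2⟩⟩⟩
    · rintro ⟨h1, h2⟩
      have h3 := (encard_natChain_inter_eq_iff hp hpq hj hji h1.1 h1.2).1 h2
      exact ⟨⟨by omega, h1, h3.1⟩, fun h4 => h3.2 ⟨h4.1, h4.2.2⟩⟩
  set Q : Set (Set ℕ+) :=
    {U | U ∈ chains p q a b i ∧ (U ∩ {v : ℕ+ | (v : ℕ) ≤ n}).encard = j} with hQ
  have hlow : natChain p q a b '' F ⊆ Q := by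
    rintro _ ⟨u, hu, rfl⟩
    obtain ⟨h1, h2⟩ := (hmemF u).1 hu
    exact ⟨⟨⟨_, rfl⟩, encard_natChain hp hpq (by omega) h1.1 h1.2⟩, h2⟩
  have hup : Q ⊆ natChain p q a b '' F ∪ natChain p q a b '' (Finset.range N : Finset ℕ) := by
    rintro U ⟨hU, hUj⟩
    by_cases hbig : ∀ v ∈ U, threshold q a b ≤ (v : ℕ)
    · left
      obtain ⟨u, h1, h2, rfl⟩ := exists_start_of_chain hp hpq hU hbig
      exact ⟨u, (hmemF u).2 ⟨⟨h1, h2⟩, hUj⟩, rfl⟩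
    · right
      push Not at hbig
      obtain ⟨v, hv, hlt⟩ := hbig
      refine ⟨v, ?_, ?_⟩
      · simp only [Finset.coe_range, Set.mem_Iio]
        omega
      · obtain ⟨⟨w, rfl⟩, -⟩ := hU
        rw [natChain, ← chain_eq_of_mem hv]
        simp
  have hfin : (natChain p q a b '' F ∪ natChain p q a b '' (Finset.range N : Finset ℕ)).Finite :=
    ((F.finite_toSet).image _).union ((Finset.range N).finite_toSet.image _)
  have hinj : Set.InjOn (natChain p q a b) F :=
    (natChain_injOn hp hpq (by omega)).mono fun u hu => ((hmemF u).1 hu).1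
  have hcF : (natChain p q a b '' F).ncard = F.card := by
    rw [hinj.ncard_image, Set.ncard_coe_finset]
  have h1 : F.card ≤ chainCount p q a b i n j := by
    rw [← hcF]
    exact Set.ncard_le_ncard hlow (hfin.subset hup)
  have h2 : chainCount p q a b i n j ≤ F.card + N := by
    calc chainCount p q a b i n j ≤ _ := Set.ncard_le_ncard hup hfin
      _ ≤ _ := Set.ncard_union_le _ _
      _ ≤ F.card + N := by
        rw [hcF]
        gcongr
        refine (Set.ncard_image_le (Finset.finite_toSet _)).trans ?_
        rw [Set.ncard_coe_finset, Finset.card_range]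
  rw [← hFcard, abs_le]
  have h1' : (F.card : ℝ) ≤ chainCount p q a b i n j := by exact_mod_cast h1
  have h2' : (chainCount p q a b i n j : ℝ) ≤ F.card + N := by exact_mod_cast h2
  have h3 : (0 : ℝ) ≤ N := Nat.cast_nonneg N
  constructor <;> linarith

theorem tendsto_chainCount_div (hp : 1 ≤ p) (hpq : p < q) {i j : ℕ} (hj : 1 ≤ j) (hji : j ≤ i)
    {β : ℝ} (hβ : HasDensity {u : ℕ | ¬ IsTarget q b u ∧ HasLength p q a b i u} β) :
    Tendsto (fun n : ℕ => (chainCount p q a b i n j : ℝ) / n) atTop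
      (𝓝 (β * ((p : ℝ) / q) ^ (j - 1) - if j < i then β * ((p : ℝ) / q) ^ j else 0)) := by
  have h1 := tendsto_card_startsUpTo_div hp hpq hβ (j - 1)
  rw [if_pos (by omega)] at h1
  have h2 := h1.sub (tendsto_card_startsUpTo_div hp hpq hβ j)
  have h3 : Tendsto (fun n : ℕ => ((chainCount p q a b i n j : ℝ)
      - (((startsUpTo p q a b i (j - 1) n).card : ℝ) - (startsUpTo p q a b i j n).card)) / n)
      atTop (𝓝 0) := by
    refine tendsto_div_natCast_of_abs_sub_le (C := ((threshold q a b).toNat : ℝ)) fun n => ?_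
    rw [zero_mul, sub_zero]
    exact abs_chainCount_sub_le hp hpq hj hji n
  have h4 := h2.add h3
  rw [add_zero] at h4
  refine h4.congr fun n => ?_
  rw [← sub_div, ← add_div]
  congr 1
  ring

end AffineShift

/-! ### Identification of `t_{φ;i}` with the partition sum. -/

namespace AffineShift

variable {m p q : ℕ} {a b : ℤ} {A : Matrix (Fin m) (Fin m) ℝ} {ρ : ℝ} {P : ℕ → ℕ → ℝ} {i : ℕ}

/-- With exponent `ρ - 1`, the factor times its own bracket is the bracket to the power `ρ`, which
is the recursion of `transfer`. -/
theorem bracket_eq_transfer (hbin : ∀ i j, A i j = 0 ∨ A i j = 1) (hrow : ∀ i, ∃ j, A i j = 1)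
    (hρ : 0 ≤ ρ) (hP : ∀ k, 1 ≤ k → k < i → expo P i k = ρ - 1) (k : ℕ) (hk : k ≤ i) (s : Fin m) :
    bracket A P i k s = transfer A ρ k s := by
  induction k generalizing s with
  | zero => rfl
  | succ k ih =>
    cases k with
    | zero => simp [bracket, transfer]
    | succ k =>
      rw [bracket, transfer]
      refine Finset.sum_congr rfl fun b _ => ?_
      have hpos : 0 < transfer A ρ (k + 1) b :=
        zero_lt_one.trans_le (one_le_transfer hbin hrow hρ _ _)
      rw [ih (by omega), hP (k + 1) (by omega) (by omega), mul_assoc,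
        Real.rpow_sub_one hpos.ne', div_mul_cancel₀ _ hpos.ne']

/-- The weight `f` on the first letter is there for the induction: once the first letter `s` is
split off, the row `A s` becomes the weight for the remaining word. -/
theorem sum_words_eq_sum_transfer (hbin : ∀ i j, A i j = 0 ∨ A i j = 1)
    (hrow : ∀ i, ∃ j, A i j = 1) (hρ : 0 ≤ ρ)
    (hP : ∀ k, 1 ≤ k → k < i → expo P i k = ρ - 1) (n : ℕ) (hn : n < i) (f : Fin m → ℝ) :
    ∑ w : Fin (n + 1) → Fin m, f (w 0) * ((∏ d : Fin n, A (w d.castSucc) (w d.succ)) *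
      ∏ d : Fin n, factor A P i (n - d) (w d.castSucc)) = ∑ s, f s * transfer A ρ n s ^ ρ := by
  induction n generalizing f with
  | zero =>
    simp only [Finset.univ_eq_empty, Finset.prod_empty, mul_one, transfer, Real.one_rpow]
    exact Fintype.sum_equiv (Equiv.funUnique (Fin 1) (Fin m)) _ _ fun w => rfl
  | succ n ih =>
    have hfac : ∀ s, factor A P i (n + 1) s * transfer A ρ (n + 1) s
        = transfer A ρ (n + 1) s ^ ρ := by
      intro s
      have hpos : 0 < transfer A ρ (n + 1) s :=
        zero_lt_one.trans_le (one_le_transfer hbin hrow hρ _ _)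
      rw [factor, bracket_eq_transfer hbin hrow hρ hP (n + 1) hn.le, hP (n + 1) (by omega) hn,
        Real.rpow_sub_one hpos.ne', div_mul_cancel₀ _ hpos.ne']
    rw [← (Fin.consEquiv (fun _ : Fin (n + 2) => Fin m)).sum_comp, Fintype.sum_prod_type]
    refine Finset.sum_congr rfl fun s _ => ?_
    rw [← hfac s, transfer, ← ih (by omega) (fun b => A s b), Finset.mul_sum, Finset.mul_sum]
    refine Finset.sum_congr rfl fun w _ => ?_
    rw [Fin.prod_univ_succ, Fin.prod_univ_succ]
    simp [Fin.consEquiv]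
    exact Or.inl (by ring)

theorem tPhi_eq_partitionSum (hbin : ∀ i j, A i j = 0 ∨ A i j = 1)
    (hrow : ∀ i, ∃ j, A i j = 1) (hρ : 0 ≤ ρ)
    (hP : ∀ k, 1 ≤ k → k < i → expo P i k = ρ - 1) (hi : 1 ≤ i) :
    tPhi A P i = partitionSum A ρ i := by
  have h := sum_words_eq_sum_transfer hbin hrow hρ hP (i - 1) (by omega) (fun _ => 1)
  simp only [one_mul] at h
  exact h

theorem transfer_le_pow (hbin : ∀ i j, A i j = 0 ∨ A i j = 1) (hrow : ∀ i, ∃ j, A i j = 1)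
    (hρ : 0 ≤ ρ) (hρ1 : ρ ≤ 1) (k : ℕ) (s : Fin m) : transfer A ρ k s ≤ (m : ℝ) ^ k := by
  induction k generalizing s with
  | zero => simp [transfer]
  | succ k ih =>
    rw [transfer]
    calc ∑ b, A s b * transfer A ρ k b ^ ρ ≤ ∑ _b : Fin m, (m : ℝ) ^ k := by
          refine Finset.sum_le_sum fun b _ => ?_
          have h1 := one_le_transfer hbin hrow hρ k b
          have h2 : transfer A ρ k b ^ ρ ≤ (m : ℝ) ^ k :=
            (Real.rpow_le_self_of_one_le h1 hρ1).trans (ih b)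
          rcases hbin s b with h | h
          · rw [h, zero_mul]; positivity
          · rw [h, one_mul]; exact h2
      _ = (m : ℝ) ^ (k + 1) := by
          rw [Finset.sum_const, Finset.card_univ, Fintype.card_fin, nsmul_eq_mul, pow_succ']

theorem partitionSum_le_pow (hbin : ∀ i j, A i j = 0 ∨ A i j = 1) (hrow : ∀ i, ∃ j, A i j = 1)
    (hρ : 0 ≤ ρ) (hρ1 : ρ ≤ 1) (hi : 1 ≤ i) : partitionSum A ρ i ≤ (m : ℝ) ^ i := by
  obtain ⟨k, rfl⟩ : ∃ k, i = k + 1 := ⟨i - 1, by omega⟩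
  rw [partitionSum, Nat.add_sub_cancel]
  calc ∑ b, transfer A ρ k b ^ ρ ≤ ∑ _b : Fin m, (m : ℝ) ^ k :=
        Finset.sum_le_sum fun b _ =>
          (Real.rpow_le_self_of_one_le (one_le_transfer hbin hrow hρ k b) hρ1).trans
            (transfer_le_pow hbin hrow hρ hρ1 k b)
    _ = (m : ℝ) ^ (k + 1) := by
        rw [Finset.sum_const, Finset.card_univ, Fintype.card_fin, nsmul_eq_mul, pow_succ']

/-- The weights of chains of `i` members with members at distance ratio `ρ`, of which exactly `j`
are counted. -/
def ratioWeight (β ρ : ℝ) (i d : ℕ) : ℝ := if d < i then β * ρ ^ d else 0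

theorem sum_Icc_ratioWeight (β ρ : ℝ) {i : ℕ} (hi : 1 ≤ i) :
    ∑ j ∈ Finset.Icc 1 i, (ratioWeight β ρ i (j - 1) - ratioWeight β ρ i j) = β := by
  have h1 : Finset.Icc 1 i = Finset.Ico 1 (i + 1) := rfl
  rw [h1, Finset.sum_Ico_eq_sum_range, Nat.add_sub_cancel]
  have h2 : ∀ k ∈ Finset.range i, ratioWeight β ρ i (1 + k - 1) - ratioWeight β ρ i (1 + k)
      = ratioWeight β ρ i k - ratioWeight β ρ i (k + 1) := by
    intro k _
    rw [add_comm 1 k, Nat.add_sub_cancel]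
  rw [Finset.sum_congr rfl h2, Finset.sum_range_sub']
  simp [ratioWeight, (by omega : 0 < i)]

/-- The denominator telescopes to `β ρ^(i-k-1)`, since the weight at depth `i` vanishes, and the
numerator is `-β ρ^(i-k-1) (1 - ρ)`. -/
theorem expo_eq_sub_one {β : ℝ} (hβ : β ≠ 0) (hρ : ρ ≠ 0)
    (hP : ∀ j, 1 ≤ j → j ≤ i → P i j = ratioWeight β ρ i (j - 1) - ratioWeight β ρ i j)
    {k : ℕ} (hk1 : 1 ≤ k) (hki : k < i) : expo P i k = ρ - 1 := by
  have hsum : ∑ l ∈ Finset.range (k + 1), P i (i - l) = β * ρ ^ (i - (k + 1)) := by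
    have h1 : ∀ l ∈ Finset.range (k + 1), P i (i - l)
        = ratioWeight β ρ i (i - (l + 1)) - ratioWeight β ρ i (i - l) := by
      intro l hl
      have := Finset.mem_range.1 hl
      rw [hP (i - l) (by omega) (by omega), Nat.sub_sub]
    rw [Finset.sum_congr rfl h1, Finset.sum_range_sub (fun l => ratioWeight β ρ i (i - l))]
    simp [ratioWeight, (by omega : i - (k + 1) < i)]
  have hk : i - k = i - (k + 1) + 1 := by omega
  rw [expo, hsum, hP (i - k) (by omega) (by omega), ratioWeight, ratioWeight, if_pos (by omega),
    if_pos (by omega), hk, Nat.add_sub_cancel, pow_succ]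
  field_simp
  ring

/-! ### The densities `P_{i,j}`, the series and its bound. -/

section Divisible

variable {g p₁ q₁ : ℕ} {c : ℤ}

theorem chainDensity_eq (hg : 0 < g) (hp₁ : 0 < p₁) (hpq₁ : p₁ < q₁) (hcop : Nat.Coprime p₁ q₁)
    {i j : ℕ} (hj : 1 ≤ j) (hji : j ≤ i) :
    Tendsto (fun n : ℕ => (chainCount (g * p₁) (g * q₁) a (a + g * c) i n j : ℝ) / n) atTop
      (𝓝 (chainDensity (g * p₁) (g * q₁) a (a + g * c) i j)) ∧
    chainDensity (g * p₁) (g * q₁) a (a + g * c) i j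
      = ratioWeight (startDensity g p₁ q₁ i) ((p₁ : ℝ) / q₁) i (j - 1)
        - ratioWeight (startDensity g p₁ q₁ i) ((p₁ : ℝ) / q₁) i j := by
  have hg0 : (g : ℝ) ≠ 0 := by positivity
  have h := tendsto_chainCount_div (i := i) (j := j) (Nat.mul_pos hg hp₁)
    (Nat.mul_lt_mul_of_pos_left hpq₁ hg) hj hji
    (hasDensity_hasLength (a := a) (c := c) hg hp₁ (by omega) hcop (by omega))
  have hρ : ((g * p₁ : ℕ) : ℝ) / ((g * q₁ : ℕ) : ℝ) = (p₁ : ℝ) / q₁ := by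
    push_cast
    exact mul_div_mul_left _ _ hg0
  rw [hρ] at h
  have heq : chainDensity (g * p₁) (g * q₁) a (a + g * c) i j
      = ratioWeight (startDensity g p₁ q₁ i) ((p₁ : ℝ) / q₁) i (j - 1)
        - ratioWeight (startDensity g p₁ q₁ i) ((p₁ : ℝ) / q₁) i j := by
    rw [chainDensity, h.limUnder_eq, ratioWeight, ratioWeight, if_pos (by omega : j - 1 < i)]
  refine ⟨?_, heq⟩
  rw [heq, ratioWeight, ratioWeight, if_pos (by omega : j - 1 < i)]
  exact h

theorem chainDensity_one_one (hg : 0 < g) (hp₁ : 0 < p₁) (hpq₁ : p₁ < q₁)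
    (hcop : Nat.Coprime p₁ q₁) : chainDensity (g * p₁) (g * q₁) a (a + g * c) 1 1
      = 1 - 1 / ((g : ℝ) * p₁) - 1 / ((g : ℝ) * q₁) + 1 / ((g : ℝ) * p₁ * q₁) := by
  rw [(chainDensity_eq hg hp₁ hpq₁ hcop le_rfl le_rfl).2, startDensity_one]
  simp [ratioWeight]

theorem chainDensity_of_lt (hg : 0 < g) (hp₁ : 0 < p₁) (hpq₁ : p₁ < q₁)
    (hcop : Nat.Coprime p₁ q₁) {i j : ℕ} (hj : 1 ≤ j) (hji : j < i) :
    chainDensity (g * p₁) (g * q₁) a (a + g * c) i j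
      = ((q₁ : ℝ) - 1) * (q₁ - p₁) / ((g : ℝ) * (q₁ : ℝ) ^ (j + 1))
        * (((p₁ : ℝ) - 1) / (p₁ : ℝ) ^ (i - j + 1)) := by
  have h1 : (g : ℝ) ≠ 0 := by positivity
  have h2 : (p₁ : ℝ) ≠ 0 := by positivity
  have h3 : (q₁ : ℝ) ≠ 0 := by
    have : 0 < q₁ := by omega
    positivity
  rw [(chainDensity_eq hg hp₁ hpq₁ hcop hj hji.le).2,
    startDensity_of_two_le hg hp₁ (by omega) (by omega), ratioWeight, ratioWeight,
    if_pos (by omega), if_pos hji]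
  obtain ⟨j, rfl⟩ : ∃ k, j = k + 1 := ⟨j - 1, by omega⟩
  obtain ⟨l, rfl⟩ : ∃ l, i = j + 1 + l := ⟨i - (j + 1), by omega⟩
  rw [Nat.add_sub_cancel, Nat.add_sub_cancel_left, div_pow, div_pow]
  field_simp
  ring

theorem chainDensity_self (hg : 0 < g) (hp₁ : 0 < p₁) (hpq₁ : p₁ < q₁)
    (hcop : Nat.Coprime p₁ q₁) {i : ℕ} (hi : 2 ≤ i) :
    chainDensity (g * p₁) (g * q₁) a (a + g * c) i i
      = ((q₁ : ℝ) - 1) / ((g : ℝ) * (q₁ : ℝ) ^ i) * (((p₁ : ℝ) - 1) / p₁) := by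
  have h1 : (g : ℝ) ≠ 0 := by positivity
  have h2 : (p₁ : ℝ) ≠ 0 := by positivity
  have h3 : (q₁ : ℝ) ≠ 0 := by
    have : 0 < q₁ := by omega
    positivity
  rw [(chainDensity_eq hg hp₁ hpq₁ hcop (by omega) le_rfl).2,
    startDensity_of_two_le hg hp₁ (by omega) hi, ratioWeight, ratioWeight,
    if_pos (by omega), if_neg (lt_irrefl _), sub_zero]
  obtain ⟨k, rfl⟩ : ∃ k, i = k + 1 := ⟨i - 1, by omega⟩
  rw [Nat.add_sub_cancel, div_pow]
  field_simp
  ring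

theorem seriesTerm_eq (hbin : ∀ i j, A i j = 0 ∨ A i j = 1) (hrow : ∀ i, ∃ j, A i j = 1)
    (hg : 0 < g) (hp₁ : 0 < p₁) (hpq₁ : p₁ < q₁) (hcop : Nat.Coprime p₁ q₁) {i : ℕ} (hi : 2 ≤ i) :
    seriesTerm A (chainDensity (g * p₁) (g * q₁) a (a + g * c)) i
      = startDensity g p₁ q₁ i * Real.logb m (partitionSum A ((p₁ : ℝ) / q₁) i) := by
  have hsum : ∑ j ∈ Finset.Icc 1 i, chainDensity (g * p₁) (g * q₁) a (a + g * c) i j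
      = startDensity g p₁ q₁ i := by
    rw [← sum_Icc_ratioWeight (startDensity g p₁ q₁ i) ((p₁ : ℝ) / q₁) (by omega : 1 ≤ i)]
    refine Finset.sum_congr rfl fun j hj => ?_
    obtain ⟨h1, h2⟩ := Finset.mem_Icc.1 hj
    exact (chainDensity_eq hg hp₁ hpq₁ hcop h1 h2).2
  rw [seriesTerm, hsum]
  -- If the density vanishes, both sides are zero whatever value the exponents take.
  by_cases h0 : startDensity g p₁ q₁ i = 0
  · rw [h0, zero_mul, zero_mul]
  · have hq : 0 < q₁ := by omega
    have hρ : (0 : ℝ) < (p₁ : ℝ) / q₁ := by positivity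
    rw [tPhi_eq_partitionSum hbin hrow hρ.le (fun k hk hki => expo_eq_sub_one h0 hρ.ne'
      (fun j h1 h2 => (chainDensity_eq hg hp₁ hpq₁ hcop h1 h2).2) hk hki) (by omega)]

/-- Since `log_m` of the partition sum is at most `i`, the `i`-th term is at most a constant times
`i p₁^(-i)`; for `p₁ = 1` all terms vanish. -/
theorem summable_seriesTerm (hm : 2 ≤ m) (hbin : ∀ i j, A i j = 0 ∨ A i j = 1)
    (hrow : ∀ i, ∃ j, A i j = 1)
    (hg : 0 < g) (hp₁ : 0 < p₁) (hpq₁ : p₁ < q₁) (hcop : Nat.Coprime p₁ q₁) :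
    Summable (fun n : ℕ =>
      seriesTerm A (chainDensity (g * p₁) (g * q₁) a (a + g * c)) (n + 2)) := by
  have hq : 0 < q₁ := by omega
  have hm1 : (1 : ℝ) < m := by exact_mod_cast hm
  have hρ : (0 : ℝ) ≤ (p₁ : ℝ) / q₁ := by positivity
  have hρ1 : (p₁ : ℝ) / q₁ ≤ 1 := (div_le_one (by positivity)).2 (by exact_mod_cast hpq₁.le)
  have hterm : ∀ n : ℕ, seriesTerm A (chainDensity (g * p₁) (g * q₁) a (a + g * c)) (n + 2)
      = ((q₁ : ℝ) - 1) / ((g : ℝ) * q₁) * (((p₁ : ℝ) - 1) / (p₁ : ℝ) ^ (n + 2))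
        * Real.logb m (partitionSum A ((p₁ : ℝ) / q₁) (n + 2)) := fun n => by
    rw [seriesTerm_eq hbin hrow hg hp₁ hpq₁ hcop (by omega),
      startDensity_of_two_le hg hp₁ hq (by omega)]
  simp only [hterm]
  rcases (by omega : p₁ = 1 ∨ 2 ≤ p₁) with rfl | hp2
  · simp
  have hp2' : (1 : ℝ) < p₁ := by exact_mod_cast hp2
  have hq1' : (1 : ℝ) ≤ q₁ := by exact_mod_cast hq
  set C : ℝ := ((q₁ : ℝ) - 1) / ((g : ℝ) * q₁) * ((p₁ : ℝ) - 1) with hC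
  have hC0 : 0 ≤ C := by
    have : 0 ≤ (q₁ : ℝ) - 1 := by linarith
    have : 0 ≤ (p₁ : ℝ) - 1 := by linarith
    positivity
  have hgeom : Summable (fun n : ℕ => C * (((n + 2 : ℕ) : ℝ) ^ 1 * ((p₁ : ℝ)⁻¹) ^ (n + 2))) := by
    refine Summable.mul_left C ?_
    refine (summable_nat_add_iff (f := fun n : ℕ => ((n : ℕ) : ℝ) ^ 1 * ((p₁ : ℝ)⁻¹) ^ n) 2).2 ?_
    refine summable_pow_mul_geometric_of_norm_lt_one 1 ?_
    rw [Real.norm_of_nonneg (by positivity)]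
    exact inv_lt_one_of_one_lt₀ hp2'
  refine Summable.of_nonneg_of_le (fun n => ?_) (fun n => ?_) hgeom
  · have h1 : 1 ≤ partitionSum A ((p₁ : ℝ) / q₁) (n + 2) :=
      hm1.le.trans (le_partitionSum hbin hrow hρ _)
    have h2 := Real.logb_nonneg hm1 h1
    have h3 : 0 ≤ (q₁ : ℝ) - 1 := by linarith
    have h4 : 0 ≤ (p₁ : ℝ) - 1 := by linarith
    positivity
  · have h1 : 0 < partitionSum A ((p₁ : ℝ) / q₁) (n + 2) :=
      (zero_lt_one.trans hm1).trans_le (le_partitionSum hbin hrow hρ _)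
    have h2 : Real.logb m (partitionSum A ((p₁ : ℝ) / q₁) (n + 2)) ≤ ((n + 2 : ℕ) : ℝ) := by
      rw [Real.logb_le_iff_le_rpow hm1 h1, Real.rpow_natCast]
      exact partitionSum_le_pow hbin hrow hρ hρ1 (by omega)
    calc ((q₁ : ℝ) - 1) / ((g : ℝ) * q₁) * (((p₁ : ℝ) - 1) / (p₁ : ℝ) ^ (n + 2))
        * Real.logb m (partitionSum A ((p₁ : ℝ) / q₁) (n + 2))
        = C * (Real.logb m (partitionSum A ((p₁ : ℝ) / q₁) (n + 2)) * ((p₁ : ℝ)⁻¹) ^ (n + 2)) := by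
          rw [hC, inv_pow]; ring
      _ ≤ _ := by rw [pow_one]; gcongr

theorem ofReal_tsum_le_dimH (hm : 2 ≤ m) (hbin : ∀ i j, A i j = 0 ∨ A i j = 1)
    (hrow : ∀ i, ∃ j, A i j = 1)
    (hg : 0 < g) (hp₁ : 0 < p₁) (hpq₁ : p₁ < q₁) (hcop : Nat.Coprime p₁ q₁)
    (hne : (shift A (g * p₁) (g * q₁) a (a + g * c)).Nonempty) :
    ENNReal.ofReal (1 - 1 / ((g : ℝ) * p₁) - 1 / ((g : ℝ) * q₁) + 1 / ((g : ℝ) * p₁ * q₁)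
        + ∑' n : ℕ, seriesTerm A (chainDensity (g * p₁) (g * q₁) a (a + g * c)) (n + 2))
      ≤ dimH (shift A (g * p₁) (g * q₁) a (a + g * c)) := by
  have hsummable := summable_seriesTerm (a := a) (c := c) hm hbin hrow hg hp₁ hpq₁ hcop
  have hlim := (hsummable.hasSum.tendsto_sum_nat.const_add
    (1 - 1 / ((g : ℝ) * p₁) - 1 / ((g : ℝ) * q₁) + 1 / ((g : ℝ) * p₁ * q₁)))
  -- Each partial sum is the bound for chains of at most `N + 1` members; the constant is the term
  -- of length one, whose partition sum is `m`.
  refine le_of_tendsto' (ENNReal.tendsto_ofReal hlim) fun N => ?_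
  have hbound := dimH_ge_sum_of_hasLength_density hm hbin hrow (Nat.mul_pos hg hp₁)
    (Nat.mul_lt_mul_of_pos_left hpq₁ hg) hne
    (fun i hi => hasDensity_hasLength hg hp₁ (by omega) hcop hi) (N + 1)
  refine le_of_eq_of_le (congrArg _ ?_) hbound
  have hρ : ((g * p₁ : ℕ) : ℝ) / ((g * q₁ : ℕ) : ℝ) = (p₁ : ℝ) / q₁ := by
    push_cast
    exact mul_div_mul_left _ _ (by positivity)
  rw [hρ, ← startDensity_one]
  clear hbound
  induction N with
  | zero =>
    have hlog : Real.logb m m = 1 := Real.logb_self_eq_one (by exact_mod_cast hm)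
    simp [partitionSum_one, hlog]
  | succ N ih =>
    rw [Finset.sum_range_succ, ← add_assoc, ih, Finset.sum_Icc_succ_top (by omega : 1 ≤ N + 1 + 1),
      seriesTerm_eq hbin hrow hg hp₁ hpq₁ hcop (by omega)]

end Divisible

end AffineShift

end

theorem proposition3p2 (m : ℕ) (hm : 2 ≤ m) (A : Matrix (Fin m) (Fin m) ℝ)
    (hbin : ∀ i j, A i j = 0 ∨ A i j = 1) (hirr : A.IsIrreducible)
    (p q : ℕ) (hp : 1 ≤ p) (hpq : p < q) (a b : ℤ) :
    (¬ ((p.gcd q : ℕ) : ℤ) ∣ b - a →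
      ENNReal.ofReal (1 - 1 / (p : ℝ) - 1 / q
          + 1 / p * Real.logb m (∑ i, (∑ j, A i j) ^ ((p : ℝ) / q)))
        ≤ dimH (AffineShift.shift A p q a b)) ∧
    (((p.gcd q : ℕ) : ℤ) ∣ b - a → 1 < p →
      ∀ p₁ q₁ : ℕ, p.gcd q * p₁ = p → p.gcd q * q₁ = q →
        (∀ i j : ℕ, 1 ≤ j → j ≤ i →
          Tendsto (fun n : ℕ => (AffineShift.chainCount p q a b i n j : ℝ) / n) atTop
            (𝓝 (AffineShift.chainDensity p q a b i j))) ∧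
        AffineShift.chainDensity p q a b 1 1
          = 1 - 1 / (p : ℝ) - 1 / q + 1 / ((p.gcd q : ℝ) * p₁ * q₁) ∧
        (∀ i j : ℕ, 1 ≤ j → j < i →
          AffineShift.chainDensity p q a b i j
            = ((q₁ : ℝ) - 1) * (q₁ - p₁) / ((p.gcd q : ℝ) * (q₁ : ℝ) ^ (j + 1))
              * (((p₁ : ℝ) - 1) / (p₁ : ℝ) ^ (i - j + 1))) ∧
        (∀ i : ℕ, 2 ≤ i →
          AffineShift.chainDensity p q a b i i
            = ((q₁ : ℝ) - 1) / ((p.gcd q : ℝ) * (q₁ : ℝ) ^ i) * (((p₁ : ℝ) - 1) / p₁)) ∧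
        Summable (fun n : ℕ =>
          AffineShift.seriesTerm A (AffineShift.chainDensity p q a b) (n + 2)) ∧
        ((AffineShift.shift A p q a b).Nonempty →
          ENNReal.ofReal (1 - 1 / (p : ℝ) - 1 / q + 1 / ((p.gcd q : ℝ) * p₁ * q₁)
              + ∑' n : ℕ, AffineShift.seriesTerm A (AffineShift.chainDensity p q a b) (n + 2))
            ≤ dimH (AffineShift.shift A p q a b))) ∧
    (p = 1 → A.IsPrimitive →
      ∃ t : Fin m → ℝ,
        ((∀ i, 0 < t i) ∧ ∀ i, t i ^ q = ∑ j, A i j * t j) ∧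
        (∀ s : Fin m → ℝ, (∀ i, 0 < s i) → (∀ i, s i ^ q = ∑ j, A i j * s j) → s = t) ∧
        ((AffineShift.shift A p q a b).Nonempty →
          ENNReal.ofReal (((q : ℝ) - 1) / q * Real.logb m (∑ i, t i))
            ≤ dimH (AffineShift.shift A p q a b))) := by
  have hrow := AffineShift.exists_apply_eq_one hm hbin hirr
  refine ⟨AffineShift.ofReal_le_dimH_of_not_dvd hm hbin hrow hp hpq, ?_, ?_⟩
  · intro hdvd _ p₁ q₁ hp₁ hq₁
    -- The gcd is replaced by a free `g` so that `p` and `q` can be eliminated in favour of `g * p₁`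
    -- and `g * q₁`.
    obtain ⟨g, hg⟩ : ∃ g, g = p.gcd q := ⟨_, rfl⟩
    rw [← hg] at hdvd hp₁ hq₁ ⊢
    obtain ⟨c, hc⟩ := hdvd
    obtain rfl : b = a + g * c := by linarith
    subst hp₁ hq₁
    have hg0 : 0 < g := Nat.pos_of_mul_pos_right hp
    have hp0 : 0 < p₁ := Nat.pos_of_mul_pos_left hp
    have hpq₁ : p₁ < q₁ := lt_of_mul_lt_mul_left hpq (Nat.zero_le g)
    have hcop : Nat.Coprime p₁ q₁ := by
      rw [Nat.gcd_mul_left] at hg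
      exact Nat.eq_of_mul_eq_mul_left hg0 (by rw [mul_one]; exact hg.symm)
    push_cast
    exact ⟨fun i j hj hji => (AffineShift.chainDensity_eq hg0 hp0 hpq₁ hcop hj hji).1,
      AffineShift.chainDensity_one_one hg0 hp0 hpq₁ hcop,
      fun i j hj hji => AffineShift.chainDensity_of_lt hg0 hp0 hpq₁ hcop hj hji,
      fun i hi => AffineShift.chainDensity_self hg0 hp0 hpq₁ hcop hi,
      AffineShift.summable_seriesTerm hm hbin hrow hg0 hp0 hpq₁ hcop,
      AffineShift.ofReal_tsum_le_dimH hm hbin hrow hg0 hp0 hpq₁ hcop⟩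
  · rintro rfl _
    obtain ⟨t, ht, huniq, hlim⟩ := AffineShift.exists_unique_fixed_vector hbin hrow hpq
    exact ⟨t, ht, huniq, fun hne =>
      AffineShift.ofReal_le_dimH_of_one hm hbin hrow hpq hne ht.1 hlim⟩
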